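/- Let $K\subseteq\mathbb{R}^d$ be closed and convex with interior $U=\mathrm{int}(K)$, and let $\Pi$ be a log-concave probability distribution supported on $K$ with potential $f$; that is, $\Pi$ has Lebesgue density proportional to $e^{-f}$ on $U$ (and zero elsewhere), where $f:U\to\mathbb{R}$ is convex and twice differentiable. Let $G$ be a metric on $U$, i.e. a differentiable map from $U$ to the symmetric positive definite $d\times d$ matrices, and write $\|v\|_{G(x)}=\sqrt{v^\top G(x)v}$. Assume that 1. $G$ is self-concordant: $|\mathrm{D}G(x)[v,v,v]|\le 2\,\|v\|_{G(x)}^3$ for all $x\in U$ and $v\in\mathbb{R}^d$, where $\mathrm{D}G(x)[v,v,v]=v^\top(\mathrm{D}G(x)[v])\,v$ and $\mathrm{D}G(x)[v]$ is the directional derivative of $G$ at $x$ in direction $v$; 2. $f$ satisfies the $(\mu,G)$-curvature lower bound for some $\mu\ge 0$: $\nabla^2 f(x)\succeq\mu\,G(x)$ for all $x\in U$. For $x,y\in U$ let $d_G(x,y)$ be the geodesic distance of the Riemannian manifold $(U,G)$, i.e. the infimum of $\int_0^1\|\gamma'(t)\|_{G(\gamma(t))}\,\mathrm{d}t$ over all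 $C^1$ curves $\gamma:[0,1]\to U$ with $\gamma(0)=x$ and $\gamma(1)=y$; put $d_G(x,y)=\infty$ if $x$ or $y$ is not in $U$. Then for every partition $\{S_1,S_2,S_3\}$ of $K$ into measurable sets (possibly empty), $$\Pi(S_3)\;\ge\;\frac{\mu}{8+4\sqrt{\mu}}\cdot\inf_{x\in S_1,\;y\in S_2}d_G(x,y)\cdot\min\{\Pi(S_1),\Pi(S_2)\},$$ with the conventions $\inf\emptyset=\infty$ and $0\cdot\infty=0$. -/

import Mathlib

open MeasureTheory Set
open scoped ENNReal Matrix

noncomputable section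

namespace RiemIso

/-- The squared local norm `⟨v, A v⟩` of a vector `v ∈ ℝᵈ`. -/
def sqNorm {d : ℕ} (A : Matrix (Fin d) (Fin d) ℝ) (v : EuclideanSpace ℝ (Fin d)) : ℝ :=
  v.ofLp ⬝ᵥ (A *ᵥ v.ofLp)

/-- The local norm `‖v‖_A = √⟨v, A v⟩`. -/
def localNorm {d : ℕ} (A : Matrix (Fin d) (Fin d) ℝ) (v : EuclideanSpace ℝ (Fin d)) : ℝ :=
  Real.sqrt (sqNorm A v)

/-- A (differentiable) metric on the open set `U ⊆ ℝᵈ`: a field of symmetric positive definite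
matrices with differentiable entries. Values of `G` outside `U` are irrelevant. -/
structure IsMetricOn {d : ℕ} (G : EuclideanSpace ℝ (Fin d) → Matrix (Fin d) (Fin d) ℝ)
    (U : Set (EuclideanSpace ℝ (Fin d))) : Prop where
  posDef : ∀ x ∈ U, (G x).PosDef
  differentiableOn : ∀ i j, DifferentiableOn ℝ (fun x => G x i j) U

/-- The directional derivative `D G(x)[v]` of a matrix field, taken entrywise. -/
def dirDeriv {d : ℕ} (G : EuclideanSpace ℝ (Fin d) → Matrix (Fin d) (Fin d) ℝ)
    (x v : EuclideanSpace ℝ (Fin d)) : Matrix (Fin d) (Fin d) ℝ :=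
  Matrix.of fun i j => fderiv ℝ (fun y => G y i j) x v

/-- Self-concordance on `U`: `|D G(x)[v, v, v]| ≤ 2 ‖v‖_{G(x)}³` for all `x ∈ U`, `v ∈ ℝᵈ`. -/
def SelfConcordantOn {d : ℕ} (G : EuclideanSpace ℝ (Fin d) → Matrix (Fin d) (Fin d) ℝ)
    (U : Set (EuclideanSpace ℝ (Fin d))) : Prop :=
  ∀ x ∈ U, ∀ v : EuclideanSpace ℝ (Fin d),
    |sqNorm (dirDeriv G x v) v| ≤ 2 * localNorm (G x) v ^ 3

/-- `f` is twice differentiable at every point of the open set `U`. -/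
def TwiceDifferentiableOn {d : ℕ} (f : EuclideanSpace ℝ (Fin d) → ℝ)
    (U : Set (EuclideanSpace ℝ (Fin d))) : Prop :=
  DifferentiableOn ℝ f U ∧ DifferentiableOn ℝ (fderiv ℝ f) U

/-- The `(μ, G)`-curvature lower bound `∇²f(x) ⪰ μ G(x)` for all `x ∈ U`, with the Loewner order
written through the quadratic forms (the Hessian of a twice differentiable function is symmetric). -/
def CurvatureLowerBoundOn {d : ℕ} (μ : ℝ)
    (G : EuclideanSpace ℝ (Fin d) → Matrix (Fin d) (Fin d) ℝ)
    (f : EuclideanSpace ℝ (Fin d) → ℝ) (U : Set (EuclideanSpace ℝ (Fin d))) : Prop :=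
  ∀ x ∈ U, ∀ v : EuclideanSpace ℝ (Fin d),
    μ * sqNorm (G x) v ≤ fderiv ℝ (fderiv ℝ f) x v v

/-- `P` is the log-concave probability distribution supported on the closed convex set `K` with
potential `f`: its Lebesgue density is proportional to `exp (-f)` on the interior of `K` and vanishes
elsewhere (the boundary of a convex set is Lebesgue-null), and `f` is convex on the interior. -/
structure IsLogConcaveDistribution {d : ℕ} (P : Measure (EuclideanSpace ℝ (Fin d)))
    (K : Set (EuclideanSpace ℝ (Fin d))) (f : EuclideanSpace ℝ (Fin d) → ℝ) : Prop where
  isClosed : IsClosed K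
  convex : Convex ℝ K
  convexOn : ConvexOn ℝ (interior K) f
  isProbabilityMeasure : IsProbabilityMeasure P
  eq_withDensity :
    P = (∫⁻ x in interior K, ENNReal.ofReal (Real.exp (-f x)))⁻¹ •
      (volume.restrict (interior K)).withDensity (fun x => ENNReal.ofReal (Real.exp (-f x)))

/-- The length `∫₀¹ ‖γ'(t)‖_{G(γ(t))} dt` of a curve `γ` on `[0, 1]`. -/
def curveLength {d : ℕ} (G : EuclideanSpace ℝ (Fin d) → Matrix (Fin d) (Fin d) ℝ)
    (γ : ℝ → EuclideanSpace ℝ (Fin d)) : ℝ≥0∞ :=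
  ∫⁻ t in Icc (0 : ℝ) 1, ENNReal.ofReal (localNorm (G (γ t)) (derivWithin γ (Icc 0 1) t))

/-- The geodesic distance of `x` and `y` in the Riemannian manifold `(U, G)`: the infimum of the
lengths of the `C¹` curves in `U` from `x` to `y`. If there is no such curve, in particular if `x` or
`y` is outside `U`, this is `∞`. -/
def geodesicDist {d : ℕ} (G : EuclideanSpace ℝ (Fin d) → Matrix (Fin d) (Fin d) ℝ)
    (U : Set (EuclideanSpace ℝ (Fin d))) (x y : EuclideanSpace ℝ (Fin d)) : ℝ≥0∞ :=
  ⨅ (γ : ℝ → EuclideanSpace ℝ (Fin d))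
    (_ : ContDiffOn ℝ 1 γ (Icc 0 1) ∧ MapsTo γ (Icc 0 1) U ∧ γ 0 = x ∧ γ 1 = y),
    curveLength G γ

end RiemIso

end

/-!
The proof reduces the inequality to thin convex bodies by bisection, and solves the problem there by
a one-dimensional argument.

*Convexity gain.* Along a line `t ↦ z + t h`, self-concordance says that the inverse square root of
`t ↦ ‖h‖²_{G (z + t h)}` is `1`-Lipschitz, so this function decays at most quadratically. With the
curvature bound, `f` then exceeds its tangent at `z` by `μ * omega r`, where `r` is the local
distance from `z` and `omega r = r - log (1 + r)` (`add_omega_le`, `convex_gain`).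

*Localization.* If the inequality fails, then `P S₃ < c * P S₁` and `P S₃ < c * P S₂` for the
constant `c` in question, and both strict inequalities persist on a compact convex body in the
interior of `K`. A half-space through a prescribed codimension-two coordinate subspace can be chosen
to halve the integral of `c * 1_{S₁} - 1_{S₃}`; on one of the two halves that of
`c * 1_{S₂} - 1_{S₃}` is still positive. Running through all rational subspaces yields nested bodies
whose intersection is at most one-dimensional, and by compactness arbitrarily thin bodies on which
both inequalities still hold (`IsGoodBody.exists_thin`). No limit of measures is taken: a single thin
body suffices.

*Thin bodies.* In a thin body, called a tube below, the metric is nearly constant on the slices where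
a suitable coordinate is fixed, so that it induces a density `N` on the range of this coordinate.
Straight segments bound the geodesic distance by the `N`-length up to a small error
(`IsTube.geodesicDist_le`). By the Prékopa–Leindler inequality (`prekopaLeindler`) and the convexity
gain, the slice masses `q` are log-concave with an additional factor `exp (-μ * omega ·)`
(`IsTube.sliceMass_gain`). Hence there is a centre away from which `q` decreases at that rate
(`exists_center`), and integration of the factor gives the Cheeger-type bound
`N τ * ∫ q ≤ M * q τ`, with the integral over the side of `τ` away from the centre and `M` close to
`4 / μ + 2 / √μ` (`lintegral_exp_omega_le`). The isoperimetric inequality on the line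
(`isoperimetry_line`) follows by exchanging the order of integration. Its constant is twice the
required one, and this slack absorbs the errors due to the thickness of the tube
(`isoperimetry_of_separated`).
-/

noncomputable section

namespace RiemIso

open Filter Topology
open scoped Pointwise

/-! ### The Prékopa–Leindler inequality -/

lemma volume_add_le_of_isCompact {A B : Set ℝ} (hA : IsCompact A) (hB : IsCompact B)
    (hA' : A.Nonempty) (hB' : B.Nonempty) : volume A + volume B ≤ volume (A + B) := by
  have ha := hA.sSup_mem hA'
  have hb := hB.sInf_mem hB'
  set a := sSup A with ha_def
  set b := sInf B with hb_def
  have h1 : ({b} + A) ∪ ({a} + B) ⊆ A + B := by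
    apply union_subset
    · rw [add_comm]
      exact add_subset_add_left (singleton_subset_iff.2 hb)
    · exact add_subset_add_right (singleton_subset_iff.2 ha)
  have h2 : ({b} + A) ∩ ({a} + B) ⊆ {a + b} := by
    rintro x ⟨⟨_, rfl, u, hu, rfl⟩, ⟨_, rfl, v, hv, h⟩⟩
    have hu' : u ≤ a := le_csSup hA.bddAbove hu
    have hv' : b ≤ v := csInf_le hB.bddBelow hv
    simp only [mem_singleton_iff] at h ⊢
    linarith
  have h3 : AEDisjoint volume ({b} + A) ({a} + B) := by
    have : volume (({b} + A) ∩ ({a} + B)) ≤ volume ({a + b} : Set ℝ) := measure_mono h2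
    simpa [AEDisjoint] using this
  have h4 : MeasurableSet ({a} + B) := (isCompact_singleton.add hB).measurableSet
  calc volume A + volume B = volume ({b} + A) + volume ({a} + B) := by
        simp [singleton_add]
    _ = volume (({b} + A) ∪ ({a} + B)) := (measure_union₀ h4.nullMeasurableSet h3).symm
    _ ≤ _ := measure_mono h1

/-- The one-dimensional Brunn–Minkowski inequality. -/
lemma volume_add_le_of_add_subset {A B C : Set ℝ} (hA : MeasurableSet A) (hB : MeasurableSet B)
    (hA' : A.Nonempty) (hB' : B.Nonempty) (h : A + B ⊆ C) :
    volume A + volume B ≤ volume C := by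
  obtain ⟨a, ha⟩ := hA'
  obtain ⟨b, hb⟩ := hB'
  by_cases hC : volume C = ∞
  · simp [hC]
  have hAC : volume A ≤ volume C := by
    have : volume ({b} + A) ≤ volume C :=
      measure_mono ((by rw [add_comm]; exact add_subset_add_left (singleton_subset_iff.2 hb)
        : {b} + A ⊆ A + B).trans h)
    simpa [singleton_add] using this
  have hBC : volume B ≤ volume C := by
    have : volume ({a} + B) ≤ volume C :=
      measure_mono ((add_subset_add_right (singleton_subset_iff.2 ha)).trans h)
    simpa [singleton_add] using this
  have hAf : volume A ≠ ∞ := ne_top_of_le_ne_top hC hAC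
  have hBf : volume B ≠ ∞ := ne_top_of_le_ne_top hC hBC
  refine ENNReal.le_of_forall_pos_le_add fun ε hε _ => ?_
  have hε2 : (ε / 2 : ℝ≥0∞) ≠ 0 := by simpa using hε.ne'
  obtain ⟨K, hKA, hK, hK'⟩ := hA.exists_isCompact_lt_add hAf hε2
  obtain ⟨L, hLB, hL, hL'⟩ := hB.exists_isCompact_lt_add hBf hε2
  have key := volume_add_le_of_isCompact (hK.union (isCompact_singleton (x := a)))
    (hL.union (isCompact_singleton (x := b))) (by simp) (by simp)
  have hsub : (K ∪ {a}) + (L ∪ {b}) ⊆ C :=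
    (add_subset_add (union_subset hKA (singleton_subset_iff.2 ha))
      (union_subset hLB (singleton_subset_iff.2 hb))).trans h
  calc volume A + volume B ≤ (volume K + ε / 2) + (volume L + ε / 2) := by gcongr
    _ = (volume K + volume L) + (ε / 2 + ε / 2) := by ring
    _ ≤ volume C + ε := by
        rw [ENNReal.add_halves]
        gcongr
        calc volume K + volume L ≤ volume (K ∪ {a}) + volume (L ∪ {b}) := by
              gcongr <;> exact subset_union_left
          _ ≤ _ := key
          _ ≤ _ := measure_mono hsub

/-- The layer cake formula for functions with values in the unit interval. -/
lemma lintegral_eq_lintegral_Ioo_volume_lt {f : ℝ → ℝ} (hf : Measurable f) (hf0 : ∀ x, 0 ≤ f x)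
    (hf1 : ∀ x, f x ≤ 1) :
    ∫⁻ x, ENNReal.ofReal (f x) = ∫⁻ l in Ioo (0 : ℝ) 1, volume {x | l < f x} := by
  rw [lintegral_eq_lintegral_meas_lt _ (ae_of_all _ hf0) hf.aemeasurable,
    ← Ioo_union_Ici_eq_Ioi zero_lt_one,
    lintegral_union measurableSet_Ici (disjoint_left.2 fun x hx hx' => not_lt.2 hx' hx.2)]
  have : ∫⁻ l in Ici (1 : ℝ), volume {x | l < f x} = 0 := by
    rw [← lintegral_zero]
    refine setLIntegral_congr_fun measurableSet_Ici fun l hl => ?_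
    have : {x | l < f x} = ∅ := by
      ext x
      simpa using (hf1 x).trans hl
    simp [this]
  rw [this, add_zero]

/-- The arithmetic form of the one-dimensional Prékopa–Leindler inequality for functions with
supremum one: each superlevel set of `h` contains the Minkowski combination of those of `f` and
`g`. -/
lemma arith_prekopaLeindler_of_sup_one {f g h : ℝ → ℝ} (hf : Measurable f) (hg : Measurable g)
    (hh : Measurable h) {t : ℝ} (ht0 : 0 < t) (ht1 : t < 1)
    (hf0 : ∀ x, 0 ≤ f x) (hf1 : ∀ x, f x ≤ 1) (hg0 : ∀ x, 0 ≤ g x) (hg1 : ∀ x, g x ≤ 1)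
    (hh0 : ∀ x, 0 ≤ h x) (hh1 : ∀ x, h x ≤ 1)
    (hfs : ∀ l < 1, ∃ x, l < f x) (hgs : ∀ l < 1, ∃ x, l < g x)
    (H : ∀ x y, f x ^ (1 - t) * g y ^ t ≤ h ((1 - t) * x + t * y)) :
    ENNReal.ofReal (1 - t) * (∫⁻ x, ENNReal.ofReal (f x)) +
      ENNReal.ofReal t * (∫⁻ x, ENNReal.ofReal (g x)) ≤ ∫⁻ x, ENNReal.ofReal (h x) := by
  have hs : 0 < 1 - t := by linarith
  have mf : Measurable fun l : ℝ => volume {x | l < f x} :=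
    Antitone.measurable fun a b hab => measure_mono fun x (hx : b < f x) => lt_of_le_of_lt hab hx
  have mg : Measurable fun l : ℝ => volume {x | l < g x} :=
    Antitone.measurable fun a b hab => measure_mono fun x (hx : b < g x) => lt_of_le_of_lt hab hx
  rw [lintegral_eq_lintegral_Ioo_volume_lt hf hf0 hf1, lintegral_eq_lintegral_Ioo_volume_lt hg hg0 hg1,
    lintegral_eq_lintegral_Ioo_volume_lt hh hh0 hh1, ← lintegral_const_mul _ mf, ← lintegral_const_mul _ mg,
    ← lintegral_add_left (mf.const_mul _)]
  refine setLIntegral_mono' measurableSet_Ioo fun l hl => ?_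
  have hA : MeasurableSet {x | l < f x} := measurableSet_lt measurable_const hf
  have hB : MeasurableSet {x | l < g x} := measurableSet_lt measurable_const hg
  have e1 : ENNReal.ofReal (1 - t) * volume {x | l < f x} = volume ((1 - t) • {x | l < f x}) := by
    rw [Measure.addHaar_smul]
    simp [abs_of_pos hs]
  have e2 : ENNReal.ofReal t * volume {x | l < g x} = volume (t • {x | l < g x}) := by
    rw [Measure.addHaar_smul]
    simp [abs_of_pos ht0]
  rw [e1, e2]
  refine volume_add_le_of_add_subset (hA.const_smul₀ _) (hB.const_smul₀ _)
    (Nonempty.smul_set (hfs l hl.2)) (Nonempty.smul_set (hgs l hl.2)) ?_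
  rintro _ ⟨_, ⟨x, hx, rfl⟩, _, ⟨y, hy, rfl⟩, rfl⟩
  have hx' : l < f x := hx
  have hy' : l < g y := hy
  refine lt_of_lt_of_le ?_ (H x y)
  calc l = l ^ (1 - t) * l ^ t := by
        rw [← Real.rpow_add hl.1]
        simp
    _ < f x ^ (1 - t) * g y ^ t := by
        have := hl.1
        have h1 : l ^ (1 - t) < f x ^ (1 - t) := Real.rpow_lt_rpow hl.1.le hx' hs
        have h2 : l ^ t < g y ^ t := Real.rpow_lt_rpow hl.1.le hy' ht0
        exact mul_lt_mul'' h1 h2 (by positivity) (by positivity)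

lemma ennreal_geom_mean_le_arith_mean {t : ℝ} (ht0 : 0 < t) (ht1 : t < 1) (a b : ℝ≥0∞) :
    a ^ (1 - t) * b ^ t ≤ ENNReal.ofReal (1 - t) * a + ENNReal.ofReal t * b := by
  have hs : 0 < 1 - t := by linarith
  by_cases ha : a = ∞
  · rw [ha, ENNReal.mul_top (by simpa using hs), top_add]
    exact le_top
  by_cases hb : b = ∞
  · rw [hb, ENNReal.mul_top (by simpa using ht0), add_top]
    exact le_top
  lift a to NNReal using ha
  lift b to NNReal using hb
  have := NNReal.geom_mean_le_arith_mean2_weighted (Real.toNNReal (1 - t)) (Real.toNNReal t) a b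
    (by rw [← Real.toNNReal_add hs.le ht0.le]; simp)
  rw [Real.coe_toNNReal _ hs.le, Real.coe_toNNReal _ ht0.le] at this
  rw [← ENNReal.coe_rpow_of_nonneg _ hs.le, ← ENNReal.coe_rpow_of_nonneg _ ht0.le]
  simp only [ENNReal.ofReal]
  exact_mod_cast this

/-- The Prékopa–Leindler inequality for bounded functions, from the arithmetic form by dividing each
function by its supremum. -/
lemma prekopaLeindler_real_of_bounded {F G H : ℝ → ℝ≥0∞} (hF : Measurable F) (hG : Measurable G)
    (hH : Measurable H) {t : ℝ} (ht0 : 0 < t) (ht1 : t < 1)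
    (hFb : ⨆ x, F x ≠ ∞) (hGb : ⨆ x, G x ≠ ∞)
    (h : ∀ x y, F x ^ (1 - t) * G y ^ t ≤ H ((1 - t) * x + t * y)) :
    (∫⁻ x, F x) ^ (1 - t) * (∫⁻ x, G x) ^ t ≤ ∫⁻ x, H x := by
  have hs : 0 < 1 - t := by linarith
  set a := ⨆ x, F x with ha
  set b := ⨆ x, G x with hb
  by_cases ha0 : a = 0
  · have : ∀ x, F x = 0 := fun x => le_antisymm ((le_iSup F x).trans ha0.le) zero_le
    simp [this, hs]
  by_cases hb0 : b = 0
  · have : ∀ x, G x = 0 := fun x => le_antisymm ((le_iSup G x).trans hb0.le) zero_le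
    simp [this, ht0]
  have hFa : ∀ x, F x / a ≤ 1 := fun x => ENNReal.div_le_of_le_mul (by simpa using le_iSup F x)
  have hGb' : ∀ x, G x / b ≤ 1 := fun x => ENNReal.div_le_of_le_mul (by simpa using le_iSup G x)
  set c := a ^ (1 - t) * b ^ t with hc
  have has0 : a ^ (1 - t) ≠ 0 := by rwa [Ne, ENNReal.rpow_eq_zero_iff_of_pos hs]
  have hbt0 : b ^ t ≠ 0 := by rwa [Ne, ENNReal.rpow_eq_zero_iff_of_pos ht0]
  have hast : a ^ (1 - t) ≠ ∞ := ENNReal.rpow_ne_top_of_nonneg hs.le hFb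
  have hbtt : b ^ t ≠ ∞ := ENNReal.rpow_ne_top_of_nonneg ht0.le hGb
  have hc0 : c ≠ 0 := mul_ne_zero has0 hbt0
  have hct : c ≠ ∞ := ENNReal.mul_ne_top hast hbtt
  have hmin : ∀ x, min (H x / c) 1 ≠ ∞ := fun x => ne_top_of_le_ne_top (by simp) (min_le_right _ _)
  have hsup : ∀ {F' : ℝ → ℝ≥0∞}, ⨆ x, F' x ≠ 0 → ⨆ x, F' x ≠ ∞ → ∀ l < (1 : ℝ),
      ∃ x, l < (F' x / ⨆ x, F' x).toReal := by
    intro F' h0 htop l hl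
    have : ENNReal.ofReal l * ⨆ x, F' x < ⨆ x, F' x := by
      conv_rhs => rw [← one_mul (⨆ x, F' x)]
      refine (ENNReal.mul_lt_mul_iff_left h0 htop).2 ?_
      simpa [ENNReal.ofReal_lt_one] using hl
    obtain ⟨x, hx⟩ := lt_iSup_iff.1 this
    refine ⟨x, ?_⟩
    have h2 : ENNReal.ofReal l < F' x / ⨆ x, F' x :=
      (ENNReal.lt_div_iff_mul_lt (Or.inl h0) (Or.inl htop)).2 hx
    have h3 := ENNReal.div_ne_top (ne_top_of_le_ne_top htop (le_iSup F' x)) h0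
    rcases lt_or_ge l 0 with h | h
    · exact h.trans_le ENNReal.toReal_nonneg
    · exact (ENNReal.ofReal_lt_iff_lt_toReal h h3).1 h2
  have key := arith_prekopaLeindler_of_sup_one (f := fun x => (F x / a).toReal)
    (g := fun x => (G x / b).toReal) (h := fun x => (min (H x / c) 1).toReal)
    (by fun_prop) (by fun_prop) (by fun_prop) ht0 ht1 (fun _ => ENNReal.toReal_nonneg)
    (fun x => by simpa using ENNReal.toReal_mono (by simp) (hFa x))
    (fun _ => ENNReal.toReal_nonneg)
    (fun x => by simpa using ENNReal.toReal_mono (by simp) (hGb' x))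
    (fun _ => ENNReal.toReal_nonneg)
    (fun x => by simpa using ENNReal.toReal_mono (b := 1) (by simp) (min_le_right (H x / c) 1))
    (hsup ha0 hFb) (hsup hb0 hGb) (by
      intro x y
      rw [ENNReal.toReal_rpow, ENNReal.toReal_rpow, ← ENNReal.toReal_mul]
      refine ENNReal.toReal_mono (hmin _) (le_min ?_ ?_)
      · rw [ENNReal.div_rpow_of_nonneg _ _ hs.le, ENNReal.div_rpow_of_nonneg _ _ ht0.le]
        rw [ENNReal.le_div_iff_mul_le (Or.inl hc0) (Or.inl hct)]
        refine le_trans (le_of_eq ?_) (h x y)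
        have e1 : F x ^ (1 - t) / a ^ (1 - t) * a ^ (1 - t) = F x ^ (1 - t) :=
          ENNReal.div_mul_cancel has0 hast
        have e2 : G y ^ t / b ^ t * b ^ t = G y ^ t :=
          ENNReal.div_mul_cancel hbt0 hbtt
        calc _ = (F x ^ (1 - t) / a ^ (1 - t) * a ^ (1 - t)) * (G y ^ t / b ^ t * b ^ t) := by
              rw [hc]; ring
          _ = _ := by rw [e1, e2]
      · exact mul_le_one' (ENNReal.rpow_le_one (hFa x) hs.le) (ENNReal.rpow_le_one (hGb' y) ht0.le))
  have eF : ∀ x, ENNReal.ofReal (F x / a).toReal = F x / a := fun x =>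
    ENNReal.ofReal_toReal (ne_top_of_le_ne_top (by simp) (hFa x))
  have eG : ∀ x, ENNReal.ofReal (G x / b).toReal = G x / b := fun x =>
    ENNReal.ofReal_toReal (ne_top_of_le_ne_top (by simp) (hGb' x))
  have eH : ∀ x, ENNReal.ofReal (min (H x / c) 1).toReal = min (H x / c) 1 := fun x =>
    ENNReal.ofReal_toReal (hmin x)
  simp only [eF, eG, eH] at key
  simp only [div_eq_mul_inv] at key
  rw [lintegral_mul_const _ hF, lintegral_mul_const _ hG] at key
  have k2 := (ennreal_geom_mean_le_arith_mean ht0 ht1 _ _).trans key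
  have k3 : ∫⁻ x, min (H x * c⁻¹) 1 ≤ (∫⁻ x, H x) * c⁻¹ := by
    rw [← lintegral_mul_const _ hH]
    exact lintegral_mono fun x => min_le_left _ _
  have k4 := k2.trans k3
  rw [← div_eq_mul_inv, ← div_eq_mul_inv, ← div_eq_mul_inv, ENNReal.le_div_iff_mul_le (Or.inl hc0)
    (Or.inl hct), ENNReal.div_rpow_of_nonneg _ _ hs.le, ENNReal.div_rpow_of_nonneg _ _ ht0.le] at k4
  refine le_trans (le_of_eq ?_) k4
  have e1 : (∫⁻ x, F x) ^ (1 - t) / a ^ (1 - t) * a ^ (1 - t) = (∫⁻ x, F x) ^ (1 - t) :=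
    ENNReal.div_mul_cancel has0 hast
  have e2 : (∫⁻ x, G x) ^ t / b ^ t * b ^ t = (∫⁻ x, G x) ^ t :=
    ENNReal.div_mul_cancel hbt0 hbtt
  calc _ = ((∫⁻ x, F x) ^ (1 - t) / a ^ (1 - t) * a ^ (1 - t)) *
        ((∫⁻ x, G x) ^ t / b ^ t * b ^ t) := by rw [e1, e2]
    _ = _ := by rw [hc]; ring

lemma tendsto_lintegral_min_natCast {α : Type*} [MeasurableSpace α] {ν : Measure α} {F : α → ℝ≥0∞}
    (hF : Measurable F) :
    Tendsto (fun k : ℕ => ∫⁻ x, min (F x) k ∂ν) atTop (𝓝 (∫⁻ x, F x ∂ν)) := by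
  refine lintegral_tendsto_of_tendsto_of_monotone (fun k => (hF.min measurable_const).aemeasurable)
    (ae_of_all _ fun x a b hab => min_le_min_left _ (by exact_mod_cast hab)) (ae_of_all _ fun x => ?_)
  have : Tendsto (fun k : ℕ => min (F x) (k : ℝ≥0∞)) atTop (𝓝 (min (F x) ∞)) :=
    tendsto_const_nhds.min ENNReal.tendsto_nat_nhds_top
  simpa using this

/-- The Prékopa–Leindler inequality on the real line. -/
theorem prekopaLeindler_real {F G H : ℝ → ℝ≥0∞} (hF : Measurable F) (hG : Measurable G)
    (hH : Measurable H) {t : ℝ} (ht0 : 0 < t) (ht1 : t < 1)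
    (h : ∀ x y, F x ^ (1 - t) * G y ^ t ≤ H ((1 - t) * x + t * y)) :
    (∫⁻ x, F x) ^ (1 - t) * (∫⁻ x, G x) ^ t ≤ ∫⁻ x, H x := by
  have hs : 0 < 1 - t := by linarith
  by_cases hF0 : ∫⁻ x, F x = 0
  · simp [hF0, hs]
  by_cases hG0 : ∫⁻ x, G x = 0
  · simp [hG0, ht0]
  have l1 := (ENNReal.continuous_rpow_const (y := 1 - t)).continuousAt.tendsto.comp
    (tendsto_lintegral_min_natCast (ν := volume) hF)
  have l2 := (ENNReal.continuous_rpow_const (y := t)).continuousAt.tendsto.comp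
    (tendsto_lintegral_min_natCast (ν := volume) hG)
  have l3 := ENNReal.Tendsto.mul l1
    (Or.inl (by rwa [Ne, ENNReal.rpow_eq_zero_iff_of_pos hs])) l2
    (Or.inl (by rwa [Ne, ENNReal.rpow_eq_zero_iff_of_pos ht0]))
  refine le_of_tendsto l3 (Eventually.of_forall fun k => ?_)
  refine prekopaLeindler_real_of_bounded (hF.min measurable_const) (hG.min measurable_const) hH
    ht0 ht1 ?_ ?_ fun x y => le_trans ?_ (h x y)
  · exact ne_top_of_le_ne_top (ENNReal.natCast_ne_top k) (iSup_le fun x => min_le_right _ _)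
  · exact ne_top_of_le_ne_top (ENNReal.natCast_ne_top k) (iSup_le fun x => min_le_right _ _)
  · gcongr <;> exact min_le_left _ _

lemma measurable_insertNth {n : ℕ} (i : Fin (n + 1)) :
    Measurable fun p : ℝ × (Fin n → ℝ) => (i.insertNth p.1 p.2 : Fin (n + 1) → ℝ) :=
  (MeasurableEquiv.piFinSuccAbove (fun _ => ℝ) i).symm.measurable

lemma lintegral_fin_succ {n : ℕ} (i : Fin (n + 1)) {F : (Fin (n + 1) → ℝ) → ℝ≥0∞}
    (hF : Measurable F) :
    ∫⁻ x, F x = ∫⁻ s, ∫⁻ y : Fin n → ℝ, F (i.insertNth s y) := by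
  rw [← (volume_preserving_piFinSuccAbove (fun _ : Fin (n + 1) => ℝ) i).symm.lintegral_comp hF,
    Measure.volume_eq_prod, lintegral_prod _ (by exact (hF.comp (measurable_insertNth i)).aemeasurable)]
  rfl

/-- The Prékopa–Leindler inequality, by induction on the dimension. -/
theorem prekopaLeindler {n : ℕ} {F G H : (Fin n → ℝ) → ℝ≥0∞} (hF : Measurable F)
    (hG : Measurable G) (hH : Measurable H) {t : ℝ} (ht0 : 0 < t) (ht1 : t < 1)
    (h : ∀ x y, F x ^ (1 - t) * G y ^ t ≤ H ((1 - t) • x + t • y)) :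
    (∫⁻ x, F x) ^ (1 - t) * (∫⁻ x, G x) ^ t ≤ ∫⁻ x, H x := by
  induction n with
  | zero =>
    have e : ∀ F : (Fin 0 → ℝ) → ℝ≥0∞, ∫⁻ x, F x = F 0 := fun F => by
      rw [volume_pi, Measure.pi_of_empty _ 0, lintegral_dirac]
    rw [e, e, e]
    simpa using h 0 0
  | succ n ih =>
    have m : ∀ {F : (Fin (n + 1) → ℝ) → ℝ≥0∞}, Measurable F →
        Measurable fun p : ℝ × (Fin n → ℝ) => F ((0 : Fin (n + 1)).insertNth p.1 p.2) :=
      fun hF => hF.comp (measurable_insertNth 0)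
    rw [lintegral_fin_succ 0 hF, lintegral_fin_succ 0 hG, lintegral_fin_succ 0 hH]
    refine prekopaLeindler_real (m hF).lintegral_prod_right' (m hG).lintegral_prod_right'
      (m hH).lintegral_prod_right' ht0 ht1 fun s u => ?_
    refine ih ((m hF).comp measurable_prodMk_left) ((m hG).comp measurable_prodMk_left)
      ((m hH).comp measurable_prodMk_left) fun x y => ?_
    refine (h _ _).trans (le_of_eq ?_)
    congr 1
    ext j
    refine Fin.cases ?_ (fun j => ?_) j <;> simp

/-! ### Local norms -/

section LocalNorm

variable {d : ℕ}

lemma sqNorm_eq_sum (A : Matrix (Fin d) (Fin d) ℝ) (v : EuclideanSpace ℝ (Fin d)) :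
    sqNorm A v = ∑ i, ∑ j, v i * (A i j * v j) := by
  simp only [sqNorm, dotProduct, Matrix.mulVec, Finset.mul_sum]

lemma sqNorm_smul (A : Matrix (Fin d) (Fin d) ℝ) (c : ℝ) (v : EuclideanSpace ℝ (Fin d)) :
    sqNorm A (c • v) = c ^ 2 * sqNorm A v := by
  simp only [sqNorm_eq_sum, Finset.mul_sum, PiLp.smul_apply, smul_eq_mul]
  refine Finset.sum_congr rfl fun i _ => Finset.sum_congr rfl fun j _ => by ring

lemma localNorm_nonneg (A : Matrix (Fin d) (Fin d) ℝ) (v : EuclideanSpace ℝ (Fin d)) :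
    0 ≤ localNorm A v := Real.sqrt_nonneg _

lemma localNorm_smul (A : Matrix (Fin d) (Fin d) ℝ) (c : ℝ) (v : EuclideanSpace ℝ (Fin d)) :
    localNorm A (c • v) = |c| * localNorm A v := by
  rw [localNorm, sqNorm_smul, Real.sqrt_mul (sq_nonneg c), Real.sqrt_sq_eq_abs, localNorm]

lemma localNorm_zero (A : Matrix (Fin d) (Fin d) ℝ) : localNorm A 0 = 0 := by
  simpa using localNorm_smul A 0 0

lemma sqNorm_pos {A : Matrix (Fin d) (Fin d) ℝ} (hA : A.PosDef) {v : EuclideanSpace ℝ (Fin d)}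
    (hv : v ≠ 0) : 0 < sqNorm A v := by
  have h := hA.dotProduct_mulVec_pos (x := v.ofLp) (by simpa using hv)
  simpa [sqNorm] using h

lemma localNorm_pos {A : Matrix (Fin d) (Fin d) ℝ} (hA : A.PosDef)
    {v : EuclideanSpace ℝ (Fin d)} (hv : v ≠ 0) : 0 < localNorm A v :=
  Real.sqrt_pos.2 (sqNorm_pos hA hv)

open scoped MatrixOrder Matrix.Norms.L2Operator in
lemma localNorm_add_le {A : Matrix (Fin d) (Fin d) ℝ} (hA : A.PosDef)
    (v w : EuclideanSpace ℝ (Fin d)) : localNorm A (v + w) ≤ localNorm A v + localNorm A w := by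
  obtain ⟨B, hB⟩ : ∃ B : Matrix (Fin d) (Fin d) ℝ, A = B.conjTranspose * B :=
    (CStarAlgebra.nonneg_iff_eq_star_mul_self (a := A)).1 hA.posSemidef.nonneg
  have key : ∀ u : EuclideanSpace ℝ (Fin d), localNorm A u = ‖WithLp.toLp 2 (B *ᵥ u.ofLp)‖ := by
    intro u
    rw [EuclideanSpace.norm_eq, localNorm, sqNorm, hB, ← Matrix.mulVec_mulVec,
      Matrix.dotProduct_mulVec, Matrix.vecMul_conjTranspose]
    simp [dotProduct, pow_two]
  rw [key, key, key]
  simpa [Matrix.mulVec_add] using norm_add_le (WithLp.toLp 2 (B *ᵥ v.ofLp))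
    (WithLp.toLp 2 (B *ᵥ w.ofLp))

end LocalNorm

/-! ### Convexity gain from self-concordance -/

/-- The self-concordant barrier function `u - log (1 + u)`: if `∇²f ⪰ G` with `G` self-concordant,
then `f` exceeds its tangent at `z` by at least this function of the local distance to `z`. -/
def omega (u : ℝ) : ℝ := u - Real.log (1 + u)

lemma omega_zero : omega 0 = 0 := by simp [omega]

lemma hasDerivAt_omega {u : ℝ} (hu : 0 ≤ u) : HasDerivAt omega (1 - 1 / (1 + u)) u := by
  have h1 : HasDerivAt (fun u : ℝ => 1 + u) 1 u := by simpa using (hasDerivAt_id u).const_add 1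
  exact (hasDerivAt_id u).sub (h1.log (by positivity))

lemma omega_mono {u v : ℝ} (hu : 0 ≤ u) (huv : u ≤ v) : omega u ≤ omega v := by
  refine monotoneOn_of_deriv_nonneg (convex_Ici 0)
    (fun x hx => (hasDerivAt_omega hx).continuousAt.continuousWithinAt)
    (fun x hx => (hasDerivAt_omega (interior_subset hx)).differentiableAt.differentiableWithinAt)
    (fun x hx => ?_) hu (hu.trans huv) huv
  have hx' : (0 : ℝ) ≤ x := interior_subset hx
  rw [(hasDerivAt_omega hx').deriv, sub_nonneg, div_le_one (by linarith)]
  linarith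

lemma omega_nonneg {u : ℝ} (hu : 0 ≤ u) : 0 ≤ omega u := by
  simpa [omega_zero] using omega_mono le_rfl hu

lemma sq_div_le_omega {u : ℝ} (hu : 0 ≤ u) : u ^ 2 / (2 * (1 + u)) ≤ omega u := by
  have hd : ∀ x : ℝ, 0 ≤ x → HasDerivAt (fun x => omega x - x ^ 2 / (2 * (1 + x)))
      ((1 - 1 / (1 + x)) - (2 * x * (2 * (1 + x)) - x ^ 2 * 2) / (2 * (1 + x)) ^ 2) x := by
    intro x hx
    refine (hasDerivAt_omega hx).sub (HasDerivAt.div ?_ ?_ (by positivity))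
    · simpa using hasDerivAt_pow 2 x
    · simpa using ((hasDerivAt_id x).const_add 1).const_mul 2
  have hm : MonotoneOn (fun x => omega x - x ^ 2 / (2 * (1 + x))) (Ici 0) := by
    refine monotoneOn_of_deriv_nonneg (convex_Ici 0)
      (fun x hx => (hd x hx).continuousAt.continuousWithinAt)
      (fun x hx => (hd x (interior_subset hx)).differentiableAt.differentiableWithinAt)
      (fun x hx => ?_)
    have hx' : (0 : ℝ) ≤ x := interior_subset hx
    rw [(hd x hx').deriv]
    have : (1 - 1 / (1 + x)) - (2 * x * (2 * (1 + x)) - x ^ 2 * 2) / (2 * (1 + x)) ^ 2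
        = x ^ 2 / (2 * (1 + x) ^ 2) := by
      field_simp
      ring
    rw [this]
    positivity
  have := hm (mem_Ici.2 le_rfl) (mem_Ici.2 hu) hu
  simp [omega_zero] at this
  linarith

/-- A positive function with `|g'| ≤ 2 g ^ (3 / 2)` decays at most quadratically, because
`1 / √g` is `1`-Lipschitz. -/
lemma sq_div_le_of_abs_deriv_le {g g' : ℝ → ℝ} {T : ℝ} (hT : 0 ≤ T)
    (hg : ∀ t ∈ Icc 0 T, HasDerivAt g (g' t) t) (hpos : ∀ t ∈ Icc 0 T, 0 < g t)
    (hg' : ∀ t ∈ Icc 0 T, |g' t| ≤ 2 * √(g t) ^ 3) :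
    √(g 0) ^ 2 / (1 + √(g 0) * T) ^ 2 ≤ g T := by
  have hd : ∀ t ∈ Icc 0 T, HasDerivAt (fun t => (√(g t))⁻¹ - t)
      (-(g' t / (2 * √(g t))) / √(g t) ^ 2 - 1) t := fun t ht =>
    (((hg t ht).sqrt (hpos t ht).ne').inv (Real.sqrt_pos.2 (hpos t ht)).ne').sub (hasDerivAt_id t)
  have hm : AntitoneOn (fun t => (√(g t))⁻¹ - t) (Icc 0 T) := by
    refine antitoneOn_of_deriv_nonpos (convex_Icc 0 T)
      (fun x hx => (hd x hx).continuousAt.continuousWithinAt)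
      (fun x hx => (hd x (interior_subset hx)).differentiableAt.differentiableWithinAt)
      (fun x hx => ?_)
    have hx' := interior_subset hx
    rw [(hd x hx').deriv]
    have hs := Real.sqrt_pos.2 (hpos x hx')
    have h2 := (abs_le.1 (hg' x hx')).1
    rw [sub_nonpos, div_le_one (by positivity), neg_le, le_div_iff₀ (by positivity)]
    nlinarith
  have h := hm (left_mem_Icc.2 hT) (right_mem_Icc.2 hT) hT
  have h0 := Real.sqrt_pos.2 (hpos 0 (left_mem_Icc.2 hT))
  have h1 := Real.sqrt_pos.2 (hpos T (right_mem_Icc.2 hT))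
  have h2 : (√(g T))⁻¹ ≤ (1 + √(g 0) * T) / √(g 0) := by
    have : (1 + √(g 0) * T) / √(g 0) = (√(g 0))⁻¹ + T := by
      field_simp
    rw [this]
    simp only [sub_zero] at h
    linarith
  have h3 : √(g 0) / (1 + √(g 0) * T) ≤ √(g T) := by
    have := inv_anti₀ (by positivity) h2
    rwa [inv_inv, inv_div] at this
  rw [← div_pow, ← Real.sq_sqrt (hpos T (right_mem_Icc.2 hT)).le]
  gcongr

section Gain

variable {d : ℕ} {G : EuclideanSpace ℝ (Fin d) → Matrix (Fin d) (Fin d) ℝ}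
  {f : EuclideanSpace ℝ (Fin d) → ℝ} {U : Set (EuclideanSpace ℝ (Fin d))} {μ : ℝ}

lemma hasDerivAt_sqNorm_line (hU : IsOpen U) (hG : IsMetricOn G U)
    {z h : EuclideanSpace ℝ (Fin d)} {t : ℝ} (ht : z + t • h ∈ U) :
    HasDerivAt (fun t : ℝ => sqNorm (G (z + t • h)) h)
      (sqNorm (dirDeriv G (z + t • h) h) h) t := by
  simp only [sqNorm_eq_sum]
  refine HasDerivAt.fun_sum fun i _ => HasDerivAt.fun_sum fun j _ => ?_
  refine HasDerivAt.const_mul _ (HasDerivAt.mul_const ?_ _)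
  have h1 := ((hG.differentiableOn i j).differentiableAt (hU.mem_nhds ht)).hasFDerivAt
  have h2 : HasDerivAt (fun t : ℝ => z + t • h) h t := by
    simpa using ((hasDerivAt_id t).smul_const h).const_add z
  exact h1.comp_hasDerivAt t h2

/-- The quantitative first-order convexity inequality: the Hessian along the segment is at least
`μ r² / (1 + r t)²`, the second derivative of `μ (r t - log (1 + r t))`. -/
lemma add_omega_le (hU : IsOpen U) (hUc : Convex ℝ U) (hG : IsMetricOn G U)
    (hGsc : SelfConcordantOn G U) (hf : TwiceDifferentiableOn f U) (hμ : 0 ≤ μ)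
    (hcurv : CurvatureLowerBoundOn μ G f U) {x z : EuclideanSpace ℝ (Fin d)} (hx : x ∈ U)
    (hz : z ∈ U) :
    f z + fderiv ℝ f z (x - z) + μ * omega (localNorm (G z) (x - z)) ≤ f x := by
  set h := x - z with hh
  by_cases h0 : h = 0
  · have : x = z := by rwa [hh, sub_eq_zero] at h0
    simp [h0, localNorm_zero, omega_zero, this]
  have hline : ∀ t ∈ Icc (0 : ℝ) 1, z + t • h ∈ U := fun t ht =>
    hUc.add_smul_sub_mem hz hx ht
  set r := localNorm (G z) h with hr
  have hr0 : 0 < r := localNorm_pos (hG.posDef z hz) h0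
  have hsc : ∀ t ∈ Icc (0 : ℝ) 1, r ^ 2 / (1 + r * t) ^ 2 ≤ sqNorm (G (z + t • h)) h := by
    intro T hT
    have hsub : Icc (0 : ℝ) T ⊆ Icc 0 1 := Icc_subset_Icc_right hT.2
    have := sq_div_le_of_abs_deriv_le (g := fun t => sqNorm (G (z + t • h)) h) hT.1
      (fun t ht => hasDerivAt_sqNorm_line hU hG (hline t (hsub ht)))
      (fun t ht => sqNorm_pos (hG.posDef _ (hline t (hsub ht))) h0)
      (fun t ht => hGsc _ (hline t (hsub ht)) h)
    simpa [hr, localNorm] using this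
  have hl : ∀ t : ℝ, HasDerivAt (fun t : ℝ => z + t • h) h t := fun t => by
    simpa using ((hasDerivAt_id t).smul_const h).const_add z
  have hrt : ∀ t ∈ Icc (0 : ℝ) 1, 0 < 1 + r * t := fun t ht => by
    have := mul_nonneg hr0.le ht.1
    linarith
  have hlin : ∀ t : ℝ, HasDerivAt (fun t : ℝ => r * t) r t := fun t => by
    simpa using (hasDerivAt_id t).const_mul r
  -- the first and second derivatives of the difference of `f` and the comparison function
  have hd1 : ∀ t ∈ Icc (0 : ℝ) 1, HasDerivAt (fun t : ℝ => f (z + t • h) - μ * omega (r * t))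
      (fderiv ℝ f (z + t • h) h - μ * ((1 - 1 / (1 + r * t)) * r)) t := by
    intro t ht
    have h1 := ((hf.1.differentiableAt (hU.mem_nhds (hline t ht))).hasFDerivAt).comp_hasDerivAt t
      (hl t)
    have h2 : HasDerivAt (fun t => omega (r * t)) ((1 - 1 / (1 + r * t)) * r) t :=
      HasDerivAt.comp t (hasDerivAt_omega (mul_nonneg hr0.le ht.1)) (hlin t)
    exact h1.sub (h2.const_mul μ)
  have hd2 : ∀ t ∈ Icc (0 : ℝ) 1, HasDerivAt
      (fun t : ℝ => fderiv ℝ f (z + t • h) h - μ * ((1 - 1 / (1 + r * t)) * r))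
      (fderiv ℝ (fderiv ℝ f) (z + t • h) h h - μ * (r ^ 2 / (1 + r * t) ^ 2)) t := by
    intro t ht
    have h1 := ((hf.2.differentiableAt (hU.mem_nhds (hline t ht))).hasFDerivAt).comp_hasDerivAt t
      (hl t)
    have h1' : HasDerivAt (fun t : ℝ => fderiv ℝ f (z + t • h) h)
        (fderiv ℝ (fderiv ℝ f) (z + t • h) h h) t := by
      simpa using h1.clm_apply (hasDerivAt_const t h)
    have h2 : HasDerivAt (fun t => (1 - 1 / (1 + r * t)) * r) (r ^ 2 / (1 + r * t) ^ 2) t := by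
      have := (((hlin t).const_add 1).fun_inv (hrt t ht).ne').const_sub 1 |>.mul_const r
      have e : r ^ 2 / (1 + r * t) ^ 2 = -(-r / (1 + r * t) ^ 2) * r := by ring
      rw [e]
      simpa using this
    exact h1'.sub (h2.const_mul μ)
  have m2 : MonotoneOn (fun t : ℝ => fderiv ℝ f (z + t • h) h - μ * ((1 - 1 / (1 + r * t)) * r))
      (Icc 0 1) := by
    refine monotoneOn_of_deriv_nonneg (convex_Icc 0 1)
      (fun t ht => (hd2 t ht).continuousAt.continuousWithinAt)
      (fun t ht => (hd2 t (interior_subset ht)).differentiableAt.differentiableWithinAt)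
      (fun t ht => ?_)
    have ht' := interior_subset ht
    rw [(hd2 t ht').deriv, sub_nonneg]
    exact (mul_le_mul_of_nonneg_left (hsc t ht') hμ).trans (hcurv _ (hline t ht') h)
  have hd3 : ∀ t ∈ Icc (0 : ℝ) 1, HasDerivAt
      (fun t : ℝ => f (z + t • h) - μ * omega (r * t) - t * fderiv ℝ f z h)
      (fderiv ℝ f (z + t • h) h - μ * ((1 - 1 / (1 + r * t)) * r) - fderiv ℝ f z h) t :=
    fun t ht => (hd1 t ht).sub (by simpa using (hasDerivAt_id t).mul_const (fderiv ℝ f z h))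
  have m1 : MonotoneOn (fun t : ℝ => f (z + t • h) - μ * omega (r * t) - t * fderiv ℝ f z h)
      (Icc 0 1) := by
    refine monotoneOn_of_deriv_nonneg (convex_Icc 0 1)
      (fun t ht => (hd3 t ht).continuousAt.continuousWithinAt)
      (fun t ht => (hd3 t (interior_subset ht)).differentiableAt.differentiableWithinAt)
      (fun t ht => ?_)
    have ht' := interior_subset ht
    rw [(hd3 t ht').deriv, sub_nonneg]
    simpa using m2 (left_mem_Icc.2 zero_le_one) ht' ht'.1
  have := m1 (left_mem_Icc.2 zero_le_one) (right_mem_Icc.2 zero_le_one) zero_le_one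
  have hzx : z + h = x := by simp [hh]
  simp [omega_zero, hzx] at this
  linarith

/-- Along a chord, convexity of `f` improves by a multiple of `omega` of the local distance from the
intermediate point to the first endpoint. -/
lemma convex_gain (hU : IsOpen U) (hUc : Convex ℝ U) (hG : IsMetricOn G U)
    (hGsc : SelfConcordantOn G U) (hf : TwiceDifferentiableOn f U) (hμ : 0 ≤ μ)
    (hcurv : CurvatureLowerBoundOn μ G f U) {x y z : EuclideanSpace ℝ (Fin d)} (hx : x ∈ U)
    (hy : y ∈ U) {t : ℝ} (ht0 : 0 < t) (ht1 : t < 1) (hz : (1 - t) • x + t • y = z) :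
    f z + (1 - t) * (μ * omega (localNorm (G z) (x - z))) ≤ (1 - t) * f x + t * f y := by
  have hzU : z ∈ U := hz ▸ hUc hx hy (by linarith) ht0.le (by ring)
  have h1 := add_omega_le hU hUc hG hGsc hf hμ hcurv hx hzU
  have h2 := add_omega_le hU hUc hG hGsc hf hμ hcurv hy hzU
  have h3 : 0 ≤ μ * omega (localNorm (G z) (y - z)) :=
    mul_nonneg hμ (omega_nonneg (localNorm_nonneg _ _))
  have h4 : (1 - t) * fderiv ℝ f z (x - z) + t * fderiv ℝ f z (y - z) = 0 := by
    rw [← smul_eq_mul, ← smul_eq_mul, ← map_smul, ← map_smul, ← map_add]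
    have : (1 - t) • (x - z) + t • (y - z) = 0 := by
      rw [← hz]
      module
    rw [this, map_zero]
  nlinarith [mul_le_mul_of_nonneg_left h1 (by linarith : 0 ≤ 1 - t),
    mul_le_mul_of_nonneg_left h2 ht0.le, mul_nonneg ht0.le h3]

end Gain

/-! ### Localization to thin convex bodies -/

section Localization

variable {d : ℕ}

/-- The affine function whose zero set is the hyperplane through the codimension-two subspace
`x i = a, x j = b` with normal direction of angle `θ` in the `(i, j)`-plane. -/
def planeForm (i j : Fin d) (a b θ : ℝ) (x : EuclideanSpace ℝ (Fin d)) : ℝ :=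
  Real.cos θ * (x i - a) + Real.sin θ * (x j - b)

lemma planeForm_add_pi (i j : Fin d) (a b θ : ℝ) (x : EuclideanSpace ℝ (Fin d)) :
    planeForm i j a b (θ + Real.pi) x = -planeForm i j a b θ x := by
  simp [planeForm, Real.cos_add_pi, Real.sin_add_pi]
  ring

lemma continuous_planeForm (i j : Fin d) (a b θ : ℝ) : Continuous (planeForm i j a b θ) := by
  unfold planeForm
  fun_prop

lemma continuous_planeForm_angle (i j : Fin d) (a b : ℝ) (x : EuclideanSpace ℝ (Fin d)) :
    Continuous fun θ => planeForm i j a b θ x := by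
  unfold planeForm
  fun_prop

lemma volume_level_set_eq_zero {L : EuclideanSpace ℝ (Fin d) →ₗ[ℝ] ℝ} (hL : L ≠ 0) (k : ℝ) :
    volume {x | L x = k} = 0 := by
  by_cases h : ∃ x₀, L x₀ = k
  · obtain ⟨x₀, hx₀⟩ := h
    have e : {x | L x = k} = (fun x => x + -x₀) ⁻¹' (LinearMap.ker L : Set _) := by
      ext x
      simp [hx₀, ← sub_eq_add_neg, sub_eq_zero]
    rw [e, measure_preimage_add_right]
    exact Measure.addHaar_submodule _ _ fun h => hL (LinearMap.ker_eq_top.1 h)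
  · have : {x | L x = k} = ∅ := by
      ext x
      simpa using fun hx => h ⟨x, hx⟩
    simp [this]

lemma ae_planeForm_ne_zero {ρ : Measure (EuclideanSpace ℝ (Fin d))} (hρ : ρ ≪ volume)
    {i j : Fin d} (hij : i ≠ j) (a b θ : ℝ) : ∀ᵐ x ∂ρ, planeForm i j a b θ x ≠ 0 := by
  refine hρ.ae_le ?_
  let L : EuclideanSpace ℝ (Fin d) →ₗ[ℝ] ℝ :=
    { toFun := fun x => Real.cos θ * x i + Real.sin θ * x j
      map_add' := fun x y => by simp; ring
      map_smul' := fun c x => by simp; ring }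
  have hL : L ≠ 0 := by
    intro h
    have h1 := LinearMap.congr_fun h (EuclideanSpace.single i 1)
    have h2 := LinearMap.congr_fun h (EuclideanSpace.single j 1)
    simp [L, hij, hij.symm] at h1 h2
    have := Real.sin_sq_add_cos_sq θ
    simp [h1, h2] at this
  have := volume_level_set_eq_zero hL (Real.cos θ * a + Real.sin θ * b)
  change ∀ᵐ x ∂volume, planeForm i j a b θ x ≠ 0
  rw [ae_iff]
  convert this using 3 with x
  simp only [planeForm, not_not, L, LinearMap.coe_mk, AddHom.coe_mk]
  funext x
  apply propext
  constructor <;> intro h <;> linarith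

variable {ρ : Measure (EuclideanSpace ℝ (Fin d))}

lemma setIntegral_planeForm_add {h : EuclideanSpace ℝ (Fin d) → ℝ} (hρ : ρ ≪ volume)
    (hh : Integrable h ρ) {i j : Fin d} (hij : i ≠ j) (a b θ : ℝ)
    (K : Set (EuclideanSpace ℝ (Fin d))) :
    ∫ x in K ∩ {x | 0 ≤ planeForm i j a b θ x}, h x ∂ρ +
      ∫ x in K ∩ {x | 0 ≤ planeForm i j a b (θ + Real.pi) x}, h x ∂ρ = ∫ x in K, h x ∂ρ := by
  have m : ∀ θ, MeasurableSet {x : EuclideanSpace ℝ (Fin d) | 0 ≤ planeForm i j a b θ x} :=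
    fun θ => measurableSet_le measurable_const (continuous_planeForm i j a b θ).measurable
  rw [inter_comm, inter_comm K, ← Measure.restrict_restrict (m _),
    ← Measure.restrict_restrict (m _), ← integral_add_compl (m θ) hh.restrict]
  congr 1
  refine setIntegral_congr_set ?_
  filter_upwards [ae_restrict_of_ae (ae_planeForm_ne_zero hρ hij a b θ)] with x hx
  apply propext
  change 0 ≤ planeForm i j a b (θ + Real.pi) x ↔ ¬ 0 ≤ planeForm i j a b θ x
  rw [planeForm_add_pi, not_le, neg_nonneg]
  exact ⟨fun h => lt_of_le_of_ne h hx, le_of_lt⟩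

/-- Some half-space through a given codimension-two coordinate subspace bisects the integral of
`h`, by the intermediate value theorem in the angle. -/
lemma exists_bisecting_angle {h : EuclideanSpace ℝ (Fin d) → ℝ} (hρ : ρ ≪ volume)
    (hh : Integrable h ρ) {i j : Fin d} (hij : i ≠ j) (a b : ℝ)
    (K : Set (EuclideanSpace ℝ (Fin d))) :
    ∃ θ, ∫ x in K ∩ {x | 0 ≤ planeForm i j a b θ x}, h x ∂ρ = (∫ x in K, h x ∂ρ) / 2 := by
  have m : ∀ θ, MeasurableSet {x : EuclideanSpace ℝ (Fin d) | 0 ≤ planeForm i j a b θ x} :=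
    fun θ => measurableSet_le measurable_const (continuous_planeForm i j a b θ).measurable
  set Φ : ℝ → ℝ := fun θ => ∫ x in K ∩ {x | 0 ≤ planeForm i j a b θ x}, h x ∂ρ with hΦ
  have hΦ' : Φ = fun θ => ∫ x in K, {x | 0 ≤ planeForm i j a b θ x}.indicator h x ∂ρ := by
    ext θ
    rw [integral_indicator (m θ), Measure.restrict_restrict (m θ), inter_comm]
  have hcont : Continuous Φ := by
    rw [hΦ', continuous_iff_continuousAt]
    intro θ₀
    refine continuousAt_of_dominated (bound := fun x => ‖h x‖)
      (Eventually.of_forall fun θ => (hh.restrict.indicator (m θ)).aestronglyMeasurable)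
      (Eventually.of_forall fun θ => ae_of_all _ fun x => norm_indicator_le_norm_self _ _)
      hh.restrict.norm ?_
    filter_upwards [ae_restrict_of_ae (ae_planeForm_ne_zero hρ hij a b θ₀)] with x hx
    have hc := (continuous_planeForm_angle i j a b x).continuousAt (x := θ₀)
    rcases lt_or_gt_of_ne hx with hx | hx
    · have : (fun θ => {x | 0 ≤ planeForm i j a b θ x}.indicator h x) =ᶠ[𝓝 θ₀] fun _ => (0 : ℝ) := by
        filter_upwards [hc.eventually_lt continuousAt_const hx] with θ hθ
        exact indicator_of_notMem (s := {x | 0 ≤ planeForm i j a b θ x}) (not_le.2 hθ) _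
      exact this.continuousAt
    · have : (fun θ => {x | 0 ≤ planeForm i j a b θ x}.indicator h x) =ᶠ[𝓝 θ₀] fun _ => h x := by
        filter_upwards [continuousAt_const.eventually_lt hc hx] with θ hθ
        exact indicator_of_mem (s := {x | 0 ≤ planeForm i j a b θ x}) (le_of_lt hθ) _
      exact this.continuousAt
  have hsum : Φ 0 + Φ (0 + Real.pi) = ∫ x in K, h x ∂ρ :=
    setIntegral_planeForm_add hρ hh hij a b 0 K
  rcases le_total (Φ 0) ((∫ x in K, h x ∂ρ) / 2) with h0 | h0
  · exact mem_range_of_exists_le_of_exists_ge hcont ⟨0, h0⟩ ⟨0 + Real.pi, by linarith⟩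
  · exact mem_range_of_exists_le_of_exists_ge hcont ⟨0 + Real.pi, by linarith⟩ ⟨0, h0⟩

/-- A compact convex set on which both functions have positive integral. -/
structure IsGoodBody (ρ : Measure (EuclideanSpace ℝ (Fin d))) (h₁ h₂ : EuclideanSpace ℝ (Fin d) → ℝ)
    (K : Set (EuclideanSpace ℝ (Fin d))) : Prop where
  isCompact : IsCompact K
  convex : Convex ℝ K
  pos₁ : 0 < ∫ x in K, h₁ x ∂ρ
  pos₂ : 0 < ∫ x in K, h₂ x ∂ρ

variable {h₁ h₂ : EuclideanSpace ℝ (Fin d) → ℝ}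

/-- The bisection step: of the two halves with equal integral of `h₁`, one has positive integral of
`h₂`. -/
lemma IsGoodBody.exists_half {K : Set (EuclideanSpace ℝ (Fin d))} (hK : IsGoodBody ρ h₁ h₂ K)
    (hρ : ρ ≪ volume) (i₁ : Integrable h₁ ρ) (i₂ : Integrable h₂ ρ) {i j : Fin d} (hij : i ≠ j)
    (a b : ℝ) :
    ∃ K' ⊆ K, IsGoodBody ρ h₁ h₂ K' ∧ ∃ θ, ∀ x ∈ K', 0 ≤ planeForm i j a b θ x := by
  obtain ⟨θ, hθ⟩ := exists_bisecting_angle hρ i₁ hij a b K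
  have s1 := setIntegral_planeForm_add hρ i₁ hij a b θ K
  have s2 := setIntegral_planeForm_add hρ i₂ hij a b θ K
  have p1 := hK.pos₁
  have p2 := hK.pos₂
  have hcl : ∀ θ, IsClosed {x : EuclideanSpace ℝ (Fin d) | 0 ≤ planeForm i j a b θ x} :=
    fun θ => isClosed_le continuous_const (continuous_planeForm i j a b θ)
  have hcv : ∀ θ, Convex ℝ {x : EuclideanSpace ℝ (Fin d) | 0 ≤ planeForm i j a b θ x} := by
    intro θ x hx y hy s t hs ht hst
    simp only [mem_ofPred_eq, planeForm, PiLp.add_apply, PiLp.smul_apply, smul_eq_mul] at hx hy ⊢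
    have e : t = 1 - s := by linarith
    subst e
    nlinarith [mul_nonneg hs hx, mul_nonneg ht hy]
  have key : ∀ θ, 0 < ∫ x in K ∩ {x | 0 ≤ planeForm i j a b θ x}, h₁ x ∂ρ →
      0 < ∫ x in K ∩ {x | 0 ≤ planeForm i j a b θ x}, h₂ x ∂ρ →
      ∃ K' ⊆ K, IsGoodBody ρ h₁ h₂ K' ∧ ∃ θ, ∀ x ∈ K', 0 ≤ planeForm i j a b θ x :=
    fun θ q1 q2 => ⟨_, inter_subset_left, ⟨hK.isCompact.inter_right (hcl θ),
      hK.convex.inter (hcv θ), q1, q2⟩, θ, fun x hx => hx.2⟩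
  rcases lt_or_ge 0 (∫ x in K ∩ {x | 0 ≤ planeForm i j a b θ x}, h₂ x ∂ρ) with q | q
  · exact key θ (by linarith) q
  · exact key (θ + Real.pi) (by linarith) (by linarith)

/-- A convex set that is cut by a supporting hyperplane through every rational point of every
coordinate plane is at most one-dimensional: some coordinate is injective on it. -/
lemma exists_injOn_coord [Nonempty (Fin d)] {K : Set (EuclideanSpace ℝ (Fin d))}
    (hK : Convex ℝ K)
    (hcut : ∀ i j : Fin d, i ≠ j → ∀ a b : ℚ, ∃ θ, ∀ x ∈ K, 0 ≤ planeForm i j a b θ x) :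
    ∃ i, ∀ x ∈ K, ∀ y ∈ K, x i = y i → x = y := by
  by_contra! hcon
  obtain ⟨x, hx, y, hy, -, hxy⟩ := hcon (Classical.arbitrary _)
  obtain ⟨j, hj⟩ : ∃ j, x j ≠ y j := by
    by_contra! h
    exact hxy (by ext j; exact h j)
  obtain ⟨u, hu, w, hw, huw, huw'⟩ := hcon j
  obtain ⟨k, hk⟩ : ∃ k, u k ≠ w k := by
    by_contra! h
    exact huw' (by ext j; exact h j)
  have hjk : j ≠ k := fun h => hk (h ▸ huw)
  -- the points `p + s (x - y) + r (u - w)` with small `s, r` fill a parallelogram inside `K`,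
  -- whose projection to the `(j, k)`-plane is nondegenerate
  set p : EuclideanSpace ℝ (Fin d) :=
    (1 / 4 : ℝ) • x + (1 / 4 : ℝ) • y + (1 / 4 : ℝ) • u + (1 / 4 : ℝ) • w with hp
  have hmem : ∀ s r : ℝ, |s| ≤ 1 / 4 → |r| ≤ 1 / 4 → p + s • (x - y) + r • (u - w) ∈ K := by
    intro s r hs hr
    rw [abs_le] at hs hr
    have m1 : (1 / 2 + 2 * s : ℝ) • x + (1 / 2 - 2 * s : ℝ) • y ∈ K :=
      hK hx hy (by linarith) (by linarith) (by ring)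
    have m2 : (1 / 2 + 2 * r : ℝ) • u + (1 / 2 - 2 * r : ℝ) • w ∈ K :=
      hK hu hw (by linarith) (by linarith) (by ring)
    have m3 := hK m1 m2 (show (0 : ℝ) ≤ 1 / 2 by norm_num) (show (0 : ℝ) ≤ 1 / 2 by norm_num)
      (by norm_num)
    convert m3 using 1
    rw [hp]
    module
  set α := x j - y j with hα
  set α' := x k - y k with hα'
  set β := u k - w k with hβ
  have hα0 : α ≠ 0 := sub_ne_zero.2 hj
  have hβ0 : β ≠ 0 := sub_ne_zero.2 hk
  have hw' : u j - w j = 0 := sub_eq_zero.2 huw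
  have hrat : ∀ q c : ℝ, c ≠ 0 → ∃ a : ℚ, ∃ s : ℝ, |s| ≤ 1 / 8 ∧ (a : ℝ) = q + s * c := by
    intro q c hc
    obtain ⟨a, ha1, ha2⟩ := exists_rat_btwn (show q - |c| / 8 < q + |c| / 8 by
      have := abs_pos.2 hc; linarith)
    refine ⟨a, (a - q) / c, ?_, by field_simp; ring⟩
    rw [abs_div, div_le_iff₀ (abs_pos.2 hc), abs_le]
    constructor <;> linarith
  obtain ⟨a, s, hs, ha⟩ := hrat (p j) α hα0
  obtain ⟨b, r, hr, hb⟩ := hrat (p k + s * α') β hβ0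
  obtain ⟨θ, hθ⟩ := hcut j k hjk a b
  have hval : ∀ s' r' : ℝ, |s'| ≤ 1 / 8 → |r'| ≤ 1 / 8 →
      0 ≤ Real.cos θ * (s' * α) + Real.sin θ * (s' * α' + r' * β) := by
    intro s' r' hs' hr'
    have := hθ _ (hmem (s + s') (r + r') ((abs_add_le _ _).trans (by linarith))
      ((abs_add_le _ _).trans (by linarith)))
    simp only [planeForm, PiLp.add_apply, PiLp.smul_apply, PiLp.sub_apply, smul_eq_mul, ← hα,
      ← hα', ← hβ, hw', ha, hb] at this
    linarith
  have e1 := hval (1 / 8) 0 (by norm_num) (by norm_num)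
  have e2 := hval (-1 / 8) 0 (by norm_num) (by norm_num)
  have e3 := hval 0 (1 / 8) (by norm_num) (by norm_num)
  have e4 := hval 0 (-1 / 8) (by norm_num) (by norm_num)
  have hsin : Real.sin θ = 0 := by
    have : Real.sin θ * β = 0 := by linarith
    exact (mul_eq_zero.1 this).resolve_right hβ0
  have hcos : Real.cos θ = 0 := by
    rw [hsin] at e1 e2
    have : Real.cos θ * α = 0 := by linarith
    exact (mul_eq_zero.1 this).resolve_right hα0
  have := Real.sin_sq_add_cos_sq θ
  simp [hsin, hcos] at this

/-- The localization lemma: two integrals that are positive over a convex body remain positive over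
some convex body inside it that is thin, in the sense that points of the latter sharing a suitable
coordinate are close. -/
theorem IsGoodBody.exists_thin [Nonempty (Fin d)] {K : Set (EuclideanSpace ℝ (Fin d))}
    (hK : IsGoodBody ρ h₁ h₂ K) (hρ : ρ ≪ volume) (i₁ : Integrable h₁ ρ) (i₂ : Integrable h₂ ρ)
    {ε : ℝ} (hε : 0 < ε) :
    ∃ K' ⊆ K, IsGoodBody ρ h₁ h₂ K' ∧ ∃ i, ∀ x ∈ K', ∀ y ∈ K', x i = y i → dist x y < ε := by
  obtain ⟨e, he⟩ := exists_surjective_nat (Fin d × Fin d × ℚ × ℚ)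
  have hstep : ∀ (L : {L // IsGoodBody ρ h₁ h₂ L}) (n : ℕ), ∃ L' : {L // IsGoodBody ρ h₁ h₂ L},
      L'.1 ⊆ L.1 ∧ ((e n).1 ≠ (e n).2.1 →
        ∃ θ, ∀ x ∈ L'.1, 0 ≤ planeForm (e n).1 (e n).2.1 (e n).2.2.1 (e n).2.2.2 θ x) := by
    intro L n
    by_cases hij : (e n).1 = (e n).2.1
    · exact ⟨L, subset_rfl, fun h => absurd hij h⟩
    · obtain ⟨L', h1, h2, h3⟩ := L.2.exists_half hρ i₁ i₂ hij (e n).2.2.1 (e n).2.2.2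
      exact ⟨⟨L', h2⟩, h1, fun _ => h3⟩
  choose F hF1 hF2 using hstep
  let S : ℕ → {L // IsGoodBody ρ h₁ h₂ L} := fun n => Nat.rec ⟨K, hK⟩ (fun n L => F L n) n
  have hS : ∀ n, (S (n + 1)).1 ⊆ (S n).1 := fun n => hF1 (S n) n
  have hanti : Antitone fun n => (S n).1 := antitone_nat_of_succ_le hS
  have hne : ∀ n, (S n).1.Nonempty := fun n => by
    by_contra h
    have := (S n).2.pos₁
    rw [not_nonempty_iff_eq_empty.1 h] at this
    simp at this
  obtain ⟨i, hi⟩ := exists_injOn_coord (K := ⋂ n, (S n).1)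
    (convex_iInter fun n => (S n).2.convex) (by
      intro i j hij a b
      obtain ⟨n, hn⟩ := he (i, j, a, b)
      obtain ⟨θ, hθ⟩ := hF2 (S n) n (by simpa [hn] using hij)
      simp only [hn] at hθ
      exact ⟨θ, fun x hx => hθ x (mem_iInter.1 hx (n + 1))⟩)
  by_contra! hcon
  let T : ℕ → Set (EuclideanSpace ℝ (Fin d) × EuclideanSpace ℝ (Fin d)) := fun n =>
    ((S n).1 ×ˢ (S n).1) ∩ {p | p.1 i = p.2 i ∧ ε ≤ dist p.1 p.2}
  have hclosed : IsClosed {p : EuclideanSpace ℝ (Fin d) × EuclideanSpace ℝ (Fin d) |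
      p.1 i = p.2 i ∧ ε ≤ dist p.1 p.2} :=
    (isClosed_eq (by fun_prop) (by fun_prop)).inter (isClosed_le continuous_const continuous_dist)
  have hTc : ∀ n, IsCompact (T n) := fun n =>
    ((S n).2.isCompact.prod (S n).2.isCompact).inter_right hclosed
  obtain ⟨⟨x, y⟩, hxy⟩ := IsCompact.nonempty_iInter_of_sequence_nonempty_isCompact_isClosed T
    (fun n => inter_subset_inter_left _ (prod_mono (hS n) (hS n)))
    (fun n => by
      obtain ⟨x, hx, y, hy, h1, h2⟩ := hcon _ (hanti (Nat.zero_le n)) (S n).2 i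
      exact ⟨(x, y), ⟨hx, hy⟩, h1, h2⟩) (hTc 0) (fun n => (hTc n).isClosed)
  have hxy' := mem_iInter.1 hxy
  have := hi x (mem_iInter.2 fun n => (hxy' n).1.1) y (mem_iInter.2 fun n => (hxy' n).1.2)
    (hxy' 0).2.1
  have h2 : ε ≤ dist x y := (hxy' 0).2.2
  rw [this, dist_self] at h2
  linarith

end Localization

/-! ### Isoperimetry on the line -/

/-- Between two points of disjoint closed sets there is an open gap joining the two sets. -/
lemma exists_gap {A B : Set ℝ} (hA : IsClosed A) (hB : IsClosed B) (hAB : Disjoint A B) {a b : ℝ}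
    (ha : a ∈ A) (hb : b ∈ B) (hab : a < b) :
    ∃ a' ∈ A, ∃ b' ∈ B, a ≤ a' ∧ a' < b' ∧ b' ≤ b ∧ Disjoint (Ioo a' b') (A ∪ B) := by
  have hA1 : IsCompact (A ∩ Icc a b) := isCompact_Icc.inter_left hA
  have ha' := hA1.sSup_mem ⟨a, ha, le_rfl, hab.le⟩
  set a' := sSup (A ∩ Icc a b)
  have hB1 : IsCompact (B ∩ Icc a' b) := isCompact_Icc.inter_left hB
  have hb' := hB1.sInf_mem ⟨b, hb, ha'.2.2, le_rfl⟩
  set b' := sInf (B ∩ Icc a' b)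
  refine ⟨a', ha'.1, b', hb'.1, ha'.2.1, ?_, hb'.2.2, ?_⟩
  · refine lt_of_le_of_ne hb'.2.1 fun h => disjoint_left.1 hAB ha'.1 ?_
    rw [h]
    exact hb'.1
  · rw [disjoint_left]
    rintro x ⟨hx1, hx2⟩ (hx | hx)
    · exact not_le.2 hx1 (le_csSup hA1.bddAbove
        ⟨hx, ha'.2.1.trans hx1.le, hx2.le.trans hb'.2.2⟩)
    · exact not_le.2 hx2 (csInf_le hB1.bddBelow ⟨hx, hx1.le, hx2.le.trans hb'.2.2⟩)

/-- A one-dimensional isoperimetric inequality: if the density `q` satisfies the Cheeger-type bounds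
`N τ * ∫ q ≤ M * q τ`, with the integral over the side of `τ` away from a centre `m`, then closed
sets at `N`-distance at least `D` are separated by a large mass. The mass at `s` is charged with the
`N`-length of the part of the complement of the two sets between `s` and `m`. -/
lemma isoperimetry_line {I A B : Set ℝ} (hI : I.OrdConnected) (hIm : MeasurableSet I)
    {q N : ℝ → ℝ≥0∞} (hq : Measurable q) (hN : Measurable N) (hA : IsClosed A) (hB : IsClosed B)
    (hAI : A ⊆ I) (hBI : B ⊆ I) {m : ℝ} {M D : ℝ≥0∞} (hD0 : D ≠ 0)
    (hL : ∀ τ ∈ I, τ < m → N τ * ∫⁻ s in Iio τ, q s ≤ M * q τ)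
    (hR : ∀ τ ∈ I, m < τ → N τ * ∫⁻ s in Ioi τ, q s ≤ M * q τ)
    (hD : ∀ a ∈ A, ∀ b ∈ B, D ≤ ∫⁻ τ in uIcc a b, N τ) :
    D * min (∫⁻ s in A, q s) (∫⁻ s in B, q s) ≤ M * ∫⁻ s in I \ (A ∪ B), q s := by
  have hAB : Disjoint A B := by
    rw [disjoint_left]
    intro x hxA hxB
    have := hD x hxA x hxB
    simp at this
    exact hD0 this
  set C := I \ (A ∪ B) with hC
  have hCm : MeasurableSet C := hIm.diff (hA.measurableSet.union hB.measurableSet)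
  set Kset : Set (ℝ × ℝ) := {p | (p.1 < p.2 ∧ p.2 < m) ∨ (m < p.2 ∧ p.2 < p.1)} with hK
  have hKm : MeasurableSet Kset := by
    refine IsOpen.measurableSet ?_
    exact ((isOpen_lt continuous_fst continuous_snd).inter
      (isOpen_lt continuous_snd continuous_const)).union
      ((isOpen_lt continuous_const continuous_snd).inter
      (isOpen_lt continuous_snd continuous_fst))
  -- the density in `τ` of the path from `s` to `m`, restricted to `C`
  set J : ℝ → ℝ → ℝ≥0∞ := fun s τ => Kset.indicator (fun p => C.indicator N p.2) (s, τ) with hJ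
  have hJm : Measurable (Function.uncurry J) :=
    ((hN.indicator hCm).comp measurable_snd).indicator hKm
  -- the `N`-length of the part of `C` between `s` and `m`
  set Θ : ℝ → ℝ≥0∞ := fun s => ∫⁻ τ, J s τ with hΘ
  have hΘm : Measurable Θ := hJm.lintegral_prod_right'
  have hgap : ∀ {A' B' : Set ℝ}, IsClosed A' → IsClosed B' → Disjoint A' B' → A' ⊆ I → B' ⊆ I →
      A' ∪ B' = A ∪ B → (∀ a ∈ A', ∀ b ∈ B', D ≤ ∫⁻ τ in uIcc a b, N τ) →
      ∀ a ∈ A', ∀ b ∈ B', a < b → D ≤ Θ a + Θ b := by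
    intro A' B' hA' hB' hd hAI' hBI' hun hD' a ha b hb hab
    obtain ⟨a', ha', b', hb', h1, h2, h3, h4⟩ := exists_gap hA' hB' hd ha hb hab
    have hsub : Ioo a' b' ⊆ C := fun x hx =>
      ⟨hI.out (hAI' ha') (hBI' hb') (Ioo_subset_Icc_self hx), fun h => by
        rw [← hun] at h
        exact disjoint_left.1 h4 hx h⟩
    calc D ≤ ∫⁻ τ in uIcc a' b', N τ := hD' a' ha' b' hb'
      _ = ∫⁻ τ, (Ioo a' b').indicator N τ := by
          rw [uIcc_of_le h2.le, ← setLIntegral_congr Ioo_ae_eq_Icc,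
            lintegral_indicator measurableSet_Ioo]
      _ ≤ ∫⁻ τ, (J a τ + J b τ) := by
          refine lintegral_mono_ae ?_
          have hm0 : ∀ᵐ τ : ℝ, τ ≠ m := by simp [ae_iff]
          filter_upwards [hm0] with τ hτ
          by_cases hτI : τ ∈ Ioo a' b'
          · have hτC := hsub hτI
            rw [indicator_of_mem hτI]
            rcases lt_or_gt_of_ne hτ with hlt | hlt
            · have : (a, τ) ∈ Kset := Or.inl ⟨h1.trans_lt hτI.1, hlt⟩
              simp [hJ, indicator_of_mem this, indicator_of_mem hτC]
            · have : (b, τ) ∈ Kset := Or.inr ⟨hlt, hτI.2.trans_le h3⟩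
              simp [hJ, indicator_of_mem this, indicator_of_mem hτC]
          · rw [indicator_of_notMem hτI]
            exact zero_le
      _ = Θ a + Θ b := lintegral_add_left (hJm.comp measurable_prodMk_left) _
  have hsum : ∀ a ∈ A, ∀ b ∈ B, D ≤ Θ a + Θ b := by
    intro a ha b hb
    rcases lt_trichotomy a b with h | h | h
    · exact hgap hA hB hAB hAI hBI rfl hD a ha b hb h
    · exact absurd (h ▸ hb) (disjoint_left.1 hAB ha)
    · rw [add_comm]
      exact hgap hB hA hAB.symm hBI hAI (union_comm _ _)
        (fun b hb a ha => by rw [uIcc_comm]; exact hD a ha b hb) b hb a ha h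
  -- `Θ` is at least `θ` on `A` and at least `D - θ` on `B`, so its `q`-integral is at least
  -- `D` times the smaller of the two masses
  set θ := ⨅ a ∈ A, Θ a with hθ
  have hθA : ∀ a ∈ A, θ ≤ Θ a := fun a ha => iInf₂_le a ha
  have hθB : ∀ b ∈ B, D - θ ≤ Θ b := fun b hb => by
    rw [tsub_le_iff_left, ← tsub_le_iff_right]
    exact le_iInf₂ fun a ha => by
      rw [tsub_le_iff_right]
      exact hsum a ha b hb
  have lower : D * min (∫⁻ s in A, q s) (∫⁻ s in B, q s) ≤ ∫⁻ s, q s * Θ s := by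
    calc D * min (∫⁻ s in A, q s) (∫⁻ s in B, q s)
        ≤ (θ + (D - θ)) * min (∫⁻ s in A, q s) (∫⁻ s in B, q s) := by
          gcongr
          exact le_add_tsub
      _ ≤ (∫⁻ s in A, q s) * θ + (∫⁻ s in B, q s) * (D - θ) := by
          rw [add_mul, mul_comm θ, mul_comm (D - θ)]
          gcongr
          · exact min_le_left _ _
          · exact min_le_right _ _
      _ = (∫⁻ s in A, q s * θ) + ∫⁻ s in B, q s * (D - θ) := by
          rw [lintegral_mul_const _ hq, lintegral_mul_const _ hq]
      _ ≤ (∫⁻ s in A, q s * Θ s) + ∫⁻ s in B, q s * Θ s := by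
          gcongr 1
          · exact setLIntegral_mono (hq.mul hΘm) fun a ha => mul_le_mul_right (hθA a ha) _
          · exact setLIntegral_mono (hq.mul hΘm) fun a ha => mul_le_mul_right (hθB a ha) _
      _ = ∫⁻ s in A ∪ B, q s * Θ s := (lintegral_union hB.measurableSet hAB).symm
      _ ≤ ∫⁻ s, q s * Θ s := setLIntegral_le_lintegral _ _
  refine lower.trans ?_
  have hJq : Measurable (Function.uncurry fun s τ => q s * J s τ) :=
    (hq.comp measurable_fst).mul hJm
  calc ∫⁻ s, q s * Θ s = ∫⁻ s, ∫⁻ τ, q s * J s τ := by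
        refine lintegral_congr fun s => ?_
        exact (lintegral_const_mul (q s) (hJm.comp measurable_prodMk_left)).symm
    _ = ∫⁻ τ, ∫⁻ s, q s * J s τ := lintegral_lintegral_swap hJq.aemeasurable
    _ ≤ ∫⁻ τ, C.indicator (fun τ => M * q τ) τ := by
        refine lintegral_mono fun τ => ?_
        by_cases hτ : τ ∈ C
        swap
        · have : ∀ s, q s * J s τ = 0 := fun s => by
            have h0 : C.indicator N τ = 0 := indicator_of_notMem hτ _
            simp only [hJ, indicator_apply, h0]
            simp
          simp [this]
        rw [indicator_of_mem hτ]
        have e : ∀ {S : Set ℝ}, MeasurableSet S → (∀ s, (s, τ) ∈ Kset ↔ s ∈ S) →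
            ∫⁻ s, q s * J s τ = N τ * ∫⁻ s in S, q s := by
          intro S hS h
          rw [← lintegral_indicator hS, ← lintegral_const_mul _ (hq.indicator hS)]
          refine lintegral_congr fun s => ?_
          by_cases hs : s ∈ S
          · simp only [hJ]
            rw [indicator_of_mem ((h s).2 hs), indicator_of_mem hs, indicator_of_mem hτ, mul_comm]
          · simp only [hJ]
            rw [indicator_of_notMem (fun hh => hs ((h s).1 hh)), indicator_of_notMem hs, mul_zero,
              mul_zero]
        rcases lt_trichotomy τ m with h | h | h
        · rw [e measurableSet_Iio fun s => ?_]
          · exact hL τ hτ.1 h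
          · simp [hK, h, h.le]
        · have : ∀ s, q s * J s τ = 0 := fun s => by
            have : (s, τ) ∉ Kset := by simp [hK, h]
            simp [hJ, indicator_of_notMem this]
          simp [this]
        · rw [e measurableSet_Ioi fun s => ?_]
          · exact hR τ hτ.1 h
          · simp [hK, h, h.le]
    _ = M * ∫⁻ s in C, q s := by
        rw [lintegral_indicator hCm, lintegral_const_mul _ hq]

lemma le_mul_of_rpow_mul_rpow_le {a b c e : ℝ≥0∞} {t : ℝ} (ht0 : 0 < t) (ht1 : t < 1)
    (h : a ^ (1 - t) * b ^ t ≤ c * e ^ (1 - t)) (hcb : c ≤ b) (hc : c ≠ 0) (he : e ≠ 0) :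
    a ≤ c * e := by
  have hs : 0 < 1 - t := by linarith
  by_cases hct : c = ∞
  · rw [hct, ENNReal.top_mul he]
    exact le_top
  have h0 : c ^ t ≠ 0 := by rwa [Ne, ENNReal.rpow_eq_zero_iff_of_pos ht0]
  have htop : c ^ t ≠ ∞ := ENNReal.rpow_ne_top_of_nonneg ht0.le hct
  have h1 : a ^ (1 - t) * c ^ t ≤ (c * e) ^ (1 - t) * c ^ t := by
    calc a ^ (1 - t) * c ^ t ≤ a ^ (1 - t) * b ^ t := by gcongr
      _ ≤ c * e ^ (1 - t) := h
      _ = (c ^ (1 - t) * c ^ t) * e ^ (1 - t) := by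
          rw [← ENNReal.rpow_add _ _ hc hct]
          simp
      _ = (c * e) ^ (1 - t) * c ^ t := by
          rw [ENNReal.mul_rpow_of_nonneg _ _ hs.le]
          ring
  rw [ENNReal.mul_le_mul_iff_left h0 htop, ENNReal.rpow_le_rpow_iff hs] at h1
  exact h1

/-- A function on a bounded set of reals that is log-concave with a gain factor `E` has a centre
`m`: at each `τ` to the left of `m` the values further to the left are bounded by `q τ * E τ s`, and
symmetrically on the right. -/
lemma exists_center {I : Set ℝ} (hbelow : BddBelow I) (habove : BddAbove I)
    {q : ℝ → ℝ≥0∞} {E : ℝ → ℝ → ℝ≥0∞} (hE : ∀ τ s, E τ s ≠ 0)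
    (hq : ∀ s ∈ I, ∀ y ∈ I, ∀ t : ℝ, 0 < t → t < 1 →
      q s ^ (1 - t) * q y ^ t ≤ q ((1 - t) * s + t * y) * E ((1 - t) * s + t * y) s ^ (1 - t)) :
    ∃ m, ∀ τ ∈ I, (τ < m → ∀ s ∈ I, s < τ → q s ≤ q τ * E τ s) ∧
      (m < τ → ∀ s ∈ I, τ < s → q s ≤ q τ * E τ s) := by
  have hpt : ∀ s τ y : ℝ, (s < τ ∧ τ < y ∨ y < τ ∧ τ < s) →
      ∃ t, 0 < t ∧ t < 1 ∧ (1 - t) * s + t * y = τ := by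
    rintro s τ y (⟨h1, h2⟩ | ⟨h1, h2⟩)
    · refine ⟨(τ - s) / (y - s), div_pos (by linarith) (by linarith), ?_, ?_⟩
      · rw [div_lt_one (by linarith)]; linarith
      · have : y - s ≠ 0 := by linarith
        field_simp; ring
    · refine ⟨(s - τ) / (s - y), div_pos (by linarith) (by linarith), ?_, ?_⟩
      · rw [div_lt_one (by linarith)]; linarith
      · have : s - y ≠ 0 := by linarith
        field_simp; ring
  have key : ∀ s ∈ I, ∀ y ∈ I, ∀ τ, (s < τ ∧ τ < y ∨ y < τ ∧ τ < s) → q τ ≤ q y → q τ ≠ 0 →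
      q s ≤ q τ * E τ s := by
    intro s hs y hy τ hτ hle h0
    obtain ⟨t, ht0, ht1, rfl⟩ := hpt s τ y hτ
    exact le_mul_of_rpow_mul_rpow_le ht0 ht1 (hq s hs y hy t ht0 ht1) hle h0 (hE _ _)
  have key0 : ∀ s ∈ I, ∀ y ∈ I, ∀ τ, s < τ → τ < y → q τ = 0 → q s = 0 ∨ q y = 0 := by
    intro s hs y hy τ h1 h2 h0
    obtain ⟨t, ht0, ht1, rfl⟩ := hpt s τ y (Or.inl ⟨h1, h2⟩)
    have := hq s hs y hy t ht0 ht1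
    rw [h0, zero_mul, nonpos_iff_eq_zero, mul_eq_zero, ENNReal.rpow_eq_zero_iff_of_pos ht0,
      ENNReal.rpow_eq_zero_iff_of_pos (by linarith)] at this
    exact this
  -- of any two points, the left one is bounded on its left or the right one on its right, so the
  -- infimum of the points that are not bounded on their left is a centre
  let LG : ℝ → Prop := fun τ => ∀ s ∈ I, s < τ → q s ≤ q τ * E τ s
  let RG : ℝ → Prop := fun τ => ∀ s ∈ I, τ < s → q s ≤ q τ * E τ s
  have hor : ∀ σ ∈ I, ∀ τ ∈ I, σ < τ → LG σ ∨ RG τ := by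
    intro σ hσ τ hτ hστ
    by_cases h0 : q σ = 0 ∧ q τ = 0
    · by_contra! hcon
      simp only [LG, RG, not_forall, not_le, h0.1, h0.2, zero_mul] at hcon
      obtain ⟨⟨s, hs, hs', hs0⟩, ⟨y, hy, hy', hy0⟩⟩ := hcon
      rcases key0 s hs y hy σ hs' (hστ.trans hy') h0.1 with h | h
      · exact hs0.ne' h
      · exact hy0.ne' h
    rcases le_total (q σ) (q τ) with h | h
    · refine Or.inl fun s hs hs' => ?_
      by_cases h1 : q σ = 0
      · have := (key0 s hs τ hτ σ hs' hστ h1).resolve_right fun h2 => h0 ⟨h1, h2⟩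
        simp [this]
      · exact key s hs τ hτ σ (Or.inl ⟨hs', hστ⟩) h h1
    · refine Or.inr fun s hs hs' => ?_
      by_cases h1 : q τ = 0
      · have := (key0 σ hσ s hs τ hστ hs' h1).resolve_left fun h2 => h0 ⟨h2, h1⟩
        simp [this]
      · exact key s hs σ hσ τ (Or.inr ⟨hστ, hs'⟩) h h1
  by_cases hne : ∃ σ ∈ I, ¬ LG σ
  · refine ⟨sInf {σ ∈ I | ¬ LG σ}, fun τ hτ => ⟨fun h => ?_, fun h => ?_⟩⟩
    · by_contra hcon
      exact not_le.2 h (csInf_le (hbelow.mono (sep_subset _ _)) ⟨hτ, hcon⟩)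
    · obtain ⟨σ, hσ, hlt⟩ := (csInf_lt_iff (hbelow.mono (sep_subset _ _)) hne).1 h
      exact (hor σ hσ.1 τ hτ hlt).resolve_left hσ.2
  · push Not at hne
    obtain ⟨β, hβ⟩ := habove
    exact ⟨β, fun τ hτ => ⟨fun _ => hne τ hτ, fun h => absurd (hβ hτ) (not_le.2 h)⟩⟩

/-- The integral of the gain factor, with a shift `b` absorbing the thickness of the body. It uses
`omega u ≥ min (u ^ 2 / 4) (u / 4)`. -/
lemma lintegral_exp_omega_le {μ κ b : ℝ} (hμ : 0 < μ) (hκ : 0 < κ) (hb : 0 ≤ b) :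
    ∫⁻ u in Ioi 0, ENNReal.ofReal (Real.exp (-(μ * omega (max (κ * u - b) 0)))) ≤
      ENNReal.ofReal ((b + (4 / μ + 2 / √μ)) / κ) := by
  set φ : ℝ → ℝ := fun u => Real.exp (-(μ * κ ^ 2 / 4) * u ^ 2) + Real.exp (-(μ * κ / 4) * u) with hφ
  have hφ0 : ∀ u, 0 ≤ φ u := fun u => by positivity
  have hi1 : IntegrableOn (fun u => Real.exp (-(μ * κ ^ 2 / 4) * u ^ 2)) (Ioi 0) :=
    (integrable_exp_neg_mul_sq (by positivity)).integrableOn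
  have hi2 : IntegrableOn (fun u => Real.exp (-(μ * κ / 4) * u)) (Ioi 0) :=
    integrableOn_exp_mul_Ioi (by have : 0 < μ * κ / 4 := by positivity
                                 linarith) 0
  have hφm : Measurable φ := by fun_prop
  have hint : ∫⁻ u in Ioi 0, ENNReal.ofReal (φ u) ≤ ENNReal.ofReal ((4 / μ + 2 / √μ) / κ) := by
    have hiφ : IntegrableOn φ (Ioi 0) := hi1.add hi2
    rw [← ofReal_integral_eq_lintegral_ofReal hiφ (ae_of_all _ hφ0)]
    refine ENNReal.ofReal_le_ofReal ?_
    rw [hφ, integral_add hi1 hi2, integral_gaussian_Ioi,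
      integral_exp_mul_Ioi (by have : 0 < μ * κ / 4 := by positivity
                               linarith)]
    have e1 : √(Real.pi / (μ * κ ^ 2 / 4)) / 2 = √Real.pi / (√μ * κ) := by
      rw [Real.sqrt_div Real.pi_pos.le, Real.sqrt_div (by positivity), Real.sqrt_mul hμ.le,
        Real.sqrt_sq hκ.le, show √(4 : ℝ) = 2 by
          rw [show (4 : ℝ) = 2 ^ 2 by norm_num, Real.sqrt_sq (by norm_num)]]
      field_simp
    have e2 : √Real.pi ≤ 2 := by
      rw [Real.sqrt_le_left (by norm_num)]
      linarith [Real.pi_le_four]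
    have hsm : 0 < √μ := Real.sqrt_pos.2 hμ
    rw [e1]
    have e3 : √Real.pi / (√μ * κ) ≤ 2 / (√μ * κ) := by gcongr
    have e4 : -Real.exp (-(μ * κ / 4) * 0) / (-(μ * κ / 4)) = 4 / (μ * κ) := by
      simp
    rw [e4]
    calc _ ≤ 2 / (√μ * κ) + 4 / (μ * κ) := by gcongr
      _ = _ := by field_simp; ring
  have hpt : ∀ u ∈ Ioi (0 : ℝ), ENNReal.ofReal (Real.exp (-(μ * omega (max (κ * u - b) 0)))) ≤
      (Ioc 0 (b / κ)).indicator 1 u +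
        (Ioi 0).indicator (fun u => ENNReal.ofReal (φ u)) (u - b / κ) := by
    intro u hu
    by_cases h : u ≤ b / κ
    · rw [indicator_of_mem (show u ∈ Ioc 0 (b / κ) from ⟨hu, h⟩)]
      refine le_add_right ?_
      rw [Pi.one_apply, ENNReal.ofReal_le_one, Real.exp_le_one_iff, neg_nonpos]
      exact mul_nonneg hμ.le (omega_nonneg (le_max_right _ _))
    · push Not at h
      rw [indicator_of_mem (show u - b / κ ∈ Ioi (0 : ℝ) by simpa using h)]
      refine le_add_left (ENNReal.ofReal_le_ofReal ?_)
      set v := u - b / κ with hv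
      have hv0 : 0 < v := by simpa [hv] using h
      have e : κ * u - b = κ * v := by rw [hv]; field_simp
      have hκv : 0 < κ * v := by positivity
      rw [e, max_eq_left hκv.le]
      have hω := sq_div_le_omega hκv.le
      rcases le_total (κ * v) 1 with h1 | h1
      · have : (κ * v) ^ 2 / 4 ≤ omega (κ * v) := by
          refine le_trans ?_ hω
          gcongr
          linarith
        have h2 : Real.exp (-(μ * omega (κ * v))) ≤ Real.exp (-(μ * κ ^ 2 / 4) * v ^ 2) := by
          rw [Real.exp_le_exp]
          have := mul_le_mul_of_nonneg_left this hμ.le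
          linarith
        exact h2.trans (le_add_of_nonneg_right (Real.exp_pos _).le)
      · have : (κ * v) / 4 ≤ omega (κ * v) := by
          refine le_trans ?_ hω
          rw [div_le_div_iff₀ (by norm_num) (by positivity)]
          nlinarith
        have h2 : Real.exp (-(μ * omega (κ * v))) ≤ Real.exp (-(μ * κ / 4) * v) := by
          rw [Real.exp_le_exp]
          have := mul_le_mul_of_nonneg_left this hμ.le
          linarith
        exact h2.trans (le_add_of_nonneg_left (Real.exp_pos _).le)
  calc _ ≤ ∫⁻ u in Ioi 0, ((Ioc 0 (b / κ)).indicator 1 u +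
        (Ioi 0).indicator (fun u => ENNReal.ofReal (φ u)) (u - b / κ)) :=
        setLIntegral_mono' measurableSet_Ioi hpt
    _ ≤ ∫⁻ u, ((Ioc 0 (b / κ)).indicator 1 u +
        (Ioi 0).indicator (fun u => ENNReal.ofReal (φ u)) (u - b / κ)) :=
        setLIntegral_le_lintegral _ _
    _ = ENNReal.ofReal (b / κ) + ∫⁻ u in Ioi 0, ENNReal.ofReal (φ u) := by
        rw [lintegral_add_left (measurable_one.indicator measurableSet_Ioc),
          lintegral_indicator_one measurableSet_Ioc,
          lintegral_sub_right_eq_self ((Ioi 0).indicator (fun u => ENNReal.ofReal (φ u))) (b / κ),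
          lintegral_indicator measurableSet_Ioi]
        simp
    _ ≤ ENNReal.ofReal (b / κ) + ENNReal.ofReal ((4 / μ + 2 / √μ) / κ) := by gcongr
    _ = _ := by
        rw [← ENNReal.ofReal_add (by positivity) (by positivity), ← add_div]

/-! ### Slices of a weight by a coordinate -/

section Slices

variable {n : ℕ}

/-- The mass of the slice `x i = s` of the weight `w`. -/
def sliceMass (i : Fin (n + 1)) (w : EuclideanSpace ℝ (Fin (n + 1)) → ℝ≥0∞) (s : ℝ) : ℝ≥0∞ :=
  ∫⁻ y : Fin n → ℝ, w (WithLp.toLp 2 (i.insertNth s y))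

lemma measurable_toLp_insertNth (i : Fin (n + 1)) :
    Measurable fun p : ℝ × (Fin n → ℝ) =>
      (WithLp.toLp 2 (i.insertNth p.1 p.2 : Fin (n + 1) → ℝ)) :=
  (PiLp.volume_preserving_toLp (Fin (n + 1))).measurable.comp (measurable_insertNth i)

lemma measurable_sliceMass (i : Fin (n + 1)) {w : EuclideanSpace ℝ (Fin (n + 1)) → ℝ≥0∞}
    (hw : Measurable w) : Measurable (sliceMass i w) :=
  (hw.comp (measurable_toLp_insertNth i)).lintegral_prod_right'

lemma setLIntegral_coord_preimage (i : Fin (n + 1)) {w : EuclideanSpace ℝ (Fin (n + 1)) → ℝ≥0∞}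
    (hw : Measurable w) {S : Set ℝ} (hS : MeasurableSet S) :
    ∫⁻ x in (fun x => x i) ⁻¹' S, w x = ∫⁻ s in S, sliceMass i w s := by
  have hm : MeasurableSet ((fun x : EuclideanSpace ℝ (Fin (n + 1)) => x i) ⁻¹' S) :=
    hS.preimage (by fun_prop : Measurable fun x : EuclideanSpace ℝ (Fin (n + 1)) => x i)
  rw [← lintegral_indicator hm, ← lintegral_indicator hS,
    ← (PiLp.volume_preserving_toLp (Fin (n + 1))).lintegral_comp (hw.indicator hm),
    lintegral_fin_succ i (F := fun x =>
      ((fun x : EuclideanSpace ℝ (Fin (n + 1)) => x i) ⁻¹' S).indicator w (WithLp.toLp 2 x)) ((hw.indicator hm).comp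
      (PiLp.volume_preserving_toLp (Fin (n + 1))).measurable)]
  refine lintegral_congr fun s => ?_
  by_cases hs : s ∈ S
  · rw [indicator_of_mem hs, sliceMass]
    refine lintegral_congr fun y => indicator_of_mem ?_ _
    simpa using hs
  · rw [indicator_of_notMem hs]
    rw [← lintegral_zero (α := Fin n → ℝ) (μ := volume)]
    refine lintegral_congr fun y => indicator_of_notMem ?_ _
    simpa using hs

/-- Log-concavity of slice masses, with a gain, by the Prékopa–Leindler inequality. -/
lemma sliceMass_rpow_mul_le (i : Fin (n + 1)) {w : EuclideanSpace ℝ (Fin (n + 1)) → ℝ≥0∞}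
    (hw : Measurable w) {s y t : ℝ} (ht0 : 0 < t) (ht1 : t < 1) {e : ℝ≥0∞}
    (h : ∀ x x' : EuclideanSpace ℝ (Fin (n + 1)), x i = s → x' i = y →
      w x ^ (1 - t) * w x' ^ t ≤ w ((1 - t) • x + t • x') * e) :
    sliceMass i w s ^ (1 - t) * sliceMass i w y ^ t ≤
      sliceMass i w ((1 - t) * s + t * y) * e := by
  have hm : ∀ s, Measurable fun y : Fin n → ℝ =>
      w (WithLp.toLp 2 (i.insertNth s y : Fin (n + 1) → ℝ)) := fun s =>
    (hw.comp (measurable_toLp_insertNth i)).comp measurable_prodMk_left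
  simp only [sliceMass]
  rw [← lintegral_mul_const _ (hm _)]
  refine prekopaLeindler (hm s) (hm y) ((hm _).mul_const e) ht0 ht1 fun x x' => ?_
  refine (h _ _ (by simp) (by simp)).trans (le_of_eq ?_)
  congr 2
  ext j
  refine Fin.succAboveCases i ?_ (fun j => ?_) j <;> simp

end Slices

lemma setLIntegral_Iio_sub (g : ℝ → ℝ≥0∞) (τ : ℝ) :
    ∫⁻ s in Iio τ, g (τ - s) = ∫⁻ u in Ioi 0, g u := by
  rw [← lintegral_indicator measurableSet_Ioi, ← lintegral_indicator measurableSet_Iio,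
    ← lintegral_sub_left_eq_self _ τ]
  refine lintegral_congr fun s => ?_
  simp [indicator_apply]

lemma setLIntegral_Ioi_sub (g : ℝ → ℝ≥0∞) (τ : ℝ) :
    ∫⁻ s in Ioi τ, g (s - τ) = ∫⁻ u in Ioi 0, g u := by
  rw [← lintegral_indicator measurableSet_Ioi, ← lintegral_indicator measurableSet_Ioi,
    ← lintegral_sub_right_eq_self ((Ioi 0).indicator g) τ]
  refine lintegral_congr fun s => ?_
  simp [indicator_apply]

lemma setLIntegral_uIcc_ofReal {g : ℝ → ℝ} (hg : Continuous g) (hg0 : ∀ x, 0 ≤ g x) (a b : ℝ) :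
    ∫⁻ x in uIcc a b, ENNReal.ofReal (g x) = ENNReal.ofReal |∫ x in a..b, g x| := by
  wlog hab : a ≤ b generalizing a b
  · rw [uIcc_comm, intervalIntegral.integral_symm, abs_neg]
    exact this b a (le_of_not_ge hab)
  rw [abs_of_nonneg (intervalIntegral.integral_nonneg hab fun x _ => hg0 x),
    intervalIntegral.integral_of_le hab, uIcc_of_le hab, ← setLIntegral_congr Ioc_ae_eq_Icc]
  exact (ofReal_integral_eq_lintegral_ofReal ((hg.intervalIntegrable a b).1)
    (ae_of_all _ hg0)).symm

/-! ### Metrics on compact sets -/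

section Metric

variable {d : ℕ} {G : EuclideanSpace ℝ (Fin d) → Matrix (Fin d) (Fin d) ℝ}
  {U : Set (EuclideanSpace ℝ (Fin d))}

lemma IsMetricOn.continuousOn_localNorm (hG : IsMetricOn G U) :
    ContinuousOn (fun p : EuclideanSpace ℝ (Fin d) × EuclideanSpace ℝ (Fin d) =>
      localNorm (G p.1) p.2) (U ×ˢ univ) := by
  simp only [localNorm, sqNorm_eq_sum]
  refine ContinuousOn.sqrt (continuousOn_finsetSum _ fun i _ => continuousOn_finsetSum _
    fun j _ => ?_)
  have h1 : ContinuousOn (fun p : EuclideanSpace ℝ (Fin d) × EuclideanSpace ℝ (Fin d) =>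
      G p.1 i j) (U ×ˢ univ) :=
    (hG.differentiableOn i j).continuousOn.comp continuousOn_fst fun p hp => hp.1
  have h2 : ∀ i, Continuous fun p : EuclideanSpace ℝ (Fin d) × EuclideanSpace ℝ (Fin d) =>
      p.2 i := fun i => by fun_prop
  exact (h2 i).continuousOn.mul (h1.mul (h2 j).continuousOn)

lemma IsMetricOn.exists_norm_bound (hG : IsMetricOn G U) {K : Set (EuclideanSpace ℝ (Fin d))}
    (hK : IsCompact K) (hKU : K ⊆ U) :
    ∃ C > 0, ∀ z ∈ K, ∀ v, localNorm (G z) v ≤ C * ‖v‖ := by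
  have hT : IsCompact (K ×ˢ Metric.sphere (0 : EuclideanSpace ℝ (Fin d)) 1) :=
    hK.prod (isCompact_sphere _ _)
  obtain ⟨C, hC⟩ := hT.exists_bound_of_continuousOn
    (hG.continuousOn_localNorm.mono (prod_mono hKU (subset_univ _)))
  refine ⟨max C 1, by positivity, fun z hz v => ?_⟩
  by_cases hv : v = 0
  · simp [hv, localNorm_zero]
  have hv' : ‖v‖ ≠ 0 := norm_ne_zero_iff.2 hv
  have h1 := hC (z, ‖v‖⁻¹ • v) ⟨hz, by simp [norm_smul, hv']⟩
  have h2 : localNorm (G z) v = ‖v‖ * localNorm (G z) (‖v‖⁻¹ • v) := by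
    rw [localNorm_smul, abs_of_nonneg (by positivity)]
    field_simp
  rw [h2, mul_comm]
  gcongr
  exact (le_abs_self _).trans (h1.trans (le_max_left _ _))

/-- On a compact set the metric varies slowly at small scales, uniformly in the direction: local norms
are uniformly continuous and bounded below on the product with the unit sphere. -/
lemma IsMetricOn.exists_norm_comparison (hG : IsMetricOn G U)
    {K : Set (EuclideanSpace ℝ (Fin d))} (hK : IsCompact K) (hKU : K ⊆ U) {L : ℝ} (hL : 1 < L) :
    ∃ ε > 0, ∀ z ∈ K, ∀ z' ∈ K, dist z z' < ε → ∀ v,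
      localNorm (G z) v ≤ L * localNorm (G z') v := by
  set T := K ×ˢ Metric.sphere (0 : EuclideanSpace ℝ (Fin d)) 1 with hT_def
  have hT : IsCompact T := hK.prod (isCompact_sphere _ _)
  have hc : ContinuousOn (fun p : EuclideanSpace ℝ (Fin d) × EuclideanSpace ℝ (Fin d) =>
      localNorm (G p.1) p.2) T :=
    hG.continuousOn_localNorm.mono (prod_mono hKU (subset_univ _))
  obtain ⟨l, hl0, hl⟩ : ∃ l > 0, ∀ p ∈ T, l ≤ localNorm (G p.1) p.2 := by
    rcases T.eq_empty_or_nonempty with h | h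
    · exact ⟨1, one_pos, by simp [h]⟩
    · obtain ⟨p, hp, hmin⟩ := hT.exists_isMinOn h hc
      refine ⟨_, localNorm_pos (hG.posDef _ (hKU hp.1)) ?_, hmin⟩
      intro h0
      have := hp.2
      simp [h0] at this
  have hu := hT.uniformContinuousOn_of_continuous hc
  rw [Metric.uniformContinuousOn_iff] at hu
  obtain ⟨ε, hε, h⟩ := hu ((L - 1) * l) (mul_pos (by linarith) hl0)
  refine ⟨ε, hε, fun z hz z' hz' hd v => ?_⟩
  by_cases hv : v = 0
  · simp [hv, localNorm_zero]
  have hv' : ‖v‖ ≠ 0 := norm_ne_zero_iff.2 hv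
  have hs : ‖v‖⁻¹ • v ∈ Metric.sphere (0 : EuclideanSpace ℝ (Fin d)) 1 := by
    simp [norm_smul, hv']
  have h1 := h (z, ‖v‖⁻¹ • v) ⟨hz, hs⟩ (z', ‖v‖⁻¹ • v) ⟨hz', hs⟩ (by simpa [Prod.dist_eq] using hd)
  have h2 := hl (z', ‖v‖⁻¹ • v) ⟨hz', hs⟩
  have h3 : localNorm (G z) (‖v‖⁻¹ • v) ≤ L * localNorm (G z') (‖v‖⁻¹ • v) := by
    have := (abs_lt.1 (by rwa [Real.dist_eq] at h1)).2
    simp only at this h2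
    nlinarith
  simp only [localNorm_smul] at h3
  have h4 : 0 < |‖v‖⁻¹| := by positivity
  rw [mul_left_comm] at h3
  exact le_of_mul_le_mul_left h3 h4

/-- The geodesic distance is at most the length of the straight segment. -/
lemma geodesicDist_le_segment (hUc : Convex ℝ U) {x y : EuclideanSpace ℝ (Fin d)}
    (hx : x ∈ U) (hy : y ∈ U) :
    geodesicDist G U x y ≤
      ∫⁻ t in Icc (0 : ℝ) 1, ENNReal.ofReal (localNorm (G (x + t • (y - x))) (y - x)) := by
  have hd : ∀ t : ℝ, HasDerivAt (fun t : ℝ => x + t • (y - x)) (y - x) t := fun t => by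
    simpa using ((hasDerivAt_id t).smul_const (y - x)).const_add x
  refine (iInf₂_le (fun t : ℝ => x + t • (y - x)) ⟨?_, ?_, by simp, by simp⟩).trans
    (le_of_eq ?_)
  · refine setLIntegral_congr_fun measurableSet_Icc fun t ht => ?_
    simp only
    rw [(hd t).hasDerivWithinAt.derivWithin (uniqueDiffOn_Icc_zero_one t ht)]
  · exact (by fun_prop : ContDiff ℝ 1 fun t : ℝ => x + t • (y - x)).contDiffOn
  · exact fun t ht => hUc.add_smul_sub_mem hx hy ht

end Metric

/-! ### Isoperimetry in thin bodies -/

section Tube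

variable {n : ℕ}

/-- A compact convex body that is long in the `i`-th coordinate, between its points `p` and `p'`,
and thin in the remaining directions: local norms at points of the same slice are comparable up to a
factor `L`, and slices have local diameter at most `b / 2`. -/
structure IsTube (G : EuclideanSpace ℝ (Fin (n + 1)) → Matrix (Fin (n + 1)) (Fin (n + 1)) ℝ)
    (i : Fin (n + 1)) (L b : ℝ) (p p' : EuclideanSpace ℝ (Fin (n + 1)))
    (K : Set (EuclideanSpace ℝ (Fin (n + 1)))) : Prop where
  isCompact : IsCompact K
  convex : Convex ℝ K
  left_mem : p ∈ K
  right_mem : p' ∈ K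
  lt : p i < p' i
  mem_Icc : ∀ x ∈ K, x i ∈ Icc (p i) (p' i)
  one_le : 1 ≤ L
  nonneg : 0 ≤ b
  comparison : ∀ z ∈ K, ∀ z' ∈ K, z i = z' i → ∀ v, localNorm (G z) v ≤ L * localNorm (G z') v
  slice : ∀ z ∈ K, ∀ x ∈ K, ∀ y ∈ K, x i = y i → localNorm (G z) (x - y) ≤ b / 2

/-- The direction of the axis from `p` to `p'`, normalized to have `i`-th coordinate one. -/
def axisDir (i : Fin (n + 1)) (p p' : EuclideanSpace ℝ (Fin (n + 1))) :
    EuclideanSpace ℝ (Fin (n + 1)) :=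
  (p' i - p i)⁻¹ • (p' - p)

/-- The point of the axis from `p` to `p'` whose `i`-th coordinate is `s`, for `s` between the
coordinates of the endpoints. Other values of `s` are clamped to this range, to make the map
continuous with values in the segment. -/
def axisPoint (i : Fin (n + 1)) (p p' : EuclideanSpace ℝ (Fin (n + 1))) (s : ℝ) :
    EuclideanSpace ℝ (Fin (n + 1)) :=
  p + (max (p i) (min (p' i) s) - p i) • axisDir i p p'

/-- The one-dimensional metric density that the metric induces on the axis. -/
def axisDensity (G : EuclideanSpace ℝ (Fin (n + 1)) → Matrix (Fin (n + 1)) (Fin (n + 1)) ℝ)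
    (i : Fin (n + 1)) (p p' : EuclideanSpace ℝ (Fin (n + 1))) (s : ℝ) : ℝ :=
  localNorm (G (axisPoint i p p' s)) (axisDir i p p')

variable {G : EuclideanSpace ℝ (Fin (n + 1)) → Matrix (Fin (n + 1)) (Fin (n + 1)) ℝ}
  {i : Fin (n + 1)} {L b : ℝ} {p p' : EuclideanSpace ℝ (Fin (n + 1))}
  {K U : Set (EuclideanSpace ℝ (Fin (n + 1)))}

namespace IsTube

lemma axisPoint_mem (h : IsTube G i L b p p' K) (s : ℝ) : axisPoint i p p' s ∈ K := by
  have h1 : 0 < p' i - p i := sub_pos.2 h.lt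
  rw [axisPoint, axisDir, smul_smul]
  refine h.convex.add_smul_sub_mem h.left_mem h.right_mem ⟨?_, ?_⟩
  · exact mul_nonneg (sub_nonneg.2 (le_max_left _ _)) (inv_nonneg.2 h1.le)
  · rw [← div_eq_mul_inv, div_le_one h1]
    gcongr
    exact max_le h.lt.le (min_le_left _ _)

lemma axisDir_apply (h : IsTube G i L b p p' K) : axisDir i p p' i = 1 := by
  have h1 : p' i - p i ≠ 0 := (sub_pos.2 h.lt).ne'
  simp [axisDir, h1]

lemma axisPoint_eq {s : ℝ} (hs : s ∈ Icc (p i) (p' i)) :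
    axisPoint i p p' s = p + (s - p i) • axisDir i p p' := by
  rw [axisPoint, min_eq_right hs.2, max_eq_right hs.1]

lemma axisPoint_apply (h : IsTube G i L b p p' K) {s : ℝ} (hs : s ∈ Icc (p i) (p' i)) :
    axisPoint i p p' s i = s := by
  simp [axisPoint_eq hs, h.axisDir_apply]

lemma axisDensity_pos (h : IsTube G i L b p p' K) (hG : IsMetricOn G U) (hKU : K ⊆ U) (s : ℝ) :
    0 < axisDensity G i p p' s := by
  refine localNorm_pos (hG.posDef _ (hKU (h.axisPoint_mem s))) fun h0 => ?_
  have := h.axisDir_apply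
  rw [h0] at this
  simp at this

lemma continuous_axisDensity (h : IsTube G i L b p p' K) (hG : IsMetricOn G U) (hKU : K ⊆ U) :
    Continuous (axisDensity G i p p') := by
  have h1 : Continuous fun s => (axisPoint i p p' s, axisDir i p p') := by
    unfold axisPoint
    fun_prop
  exact hG.continuousOn_localNorm.comp_continuous h1 fun s =>
    ⟨hKU (h.axisPoint_mem s), mem_univ _⟩

/-- Chords of a tube are nearly parallel to its axis. -/
lemma chord_sub_le (h : IsTube G i L b p p' K) (hG : IsMetricOn G U) (hKU : K ⊆ U)
    {x y z : EuclideanSpace ℝ (Fin (n + 1))} (hx : x ∈ K) (hy : y ∈ K) (hz : z ∈ K) :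
    localNorm (G z) ((x - y) - (x i - y i) • axisDir i p p') ≤ b := by
  have e : (x - y) - (x i - y i) • axisDir i p p' =
      (x - axisPoint i p p' (x i)) + (axisPoint i p p' (y i) - y) := by
    rw [axisPoint_eq (h.mem_Icc x hx), axisPoint_eq (h.mem_Icc y hy)]
    module
  rw [e]
  refine (localNorm_add_le (hG.posDef _ (hKU hz)) _ _).trans ?_
  have h1 := h.slice z hz x hx _ (h.axisPoint_mem (x i))
    (h.axisPoint_apply (h.mem_Icc x hx)).symm
  have h2 := h.slice z hz _ (h.axisPoint_mem (y i)) y hy (h.axisPoint_apply (h.mem_Icc y hy))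
  linarith

lemma axis_le_chord (h : IsTube G i L b p p' K) (hG : IsMetricOn G U) (hKU : K ⊆ U)
    {x z : EuclideanSpace ℝ (Fin (n + 1))} (hx : x ∈ K) (hz : z ∈ K) :
    axisDensity G i p p' (z i) / L * |x i - z i| - b ≤ localNorm (G z) (x - z) := by
  have hL : 0 < L := lt_of_lt_of_le one_pos h.one_le
  have h1 := h.chord_sub_le hG hKU hz hx hz
  have h2 : axisDensity G i p p' (z i) / L ≤ localNorm (G z) (axisDir i p p') := by
    rw [div_le_iff₀ hL, mul_comm]
    exact h.comparison _ (h.axisPoint_mem _) z hz (h.axisPoint_apply (h.mem_Icc z hz)) _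
  have h3 : |x i - z i| * localNorm (G z) (axisDir i p p') ≤
      localNorm (G z) (x - z) + b := by
    rw [← localNorm_smul]
    have e : (x i - z i) • axisDir i p p' =
        (x - z) + ((z - x) - (z i - x i) • axisDir i p p') := by module
    rw [e]
    exact (localNorm_add_le (hG.posDef _ (hKU hz)) _ _).trans (by linarith)
  have h4 := mul_le_mul_of_nonneg_left h2 (abs_nonneg (x i - z i))
  linarith

lemma geodesicDist_le (h : IsTube G i L b p p' K) (hG : IsMetricOn G U) (hUc : Convex ℝ U)
    (hKU : K ⊆ U) {x y : EuclideanSpace ℝ (Fin (n + 1))} (hx : x ∈ K) (hy : y ∈ K) :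
    geodesicDist G U x y ≤
      ENNReal.ofReal (L * |∫ s in (x i)..(y i), axisDensity G i p p' s| + b) := by
  have hL : 0 < L := lt_of_lt_of_le one_pos h.one_le
  have hcont := h.continuous_axisDensity hG hKU
  refine (geodesicDist_le_segment hUc (hKU hx) (hKU hy)).trans ?_
  set F : ℝ → ℝ := fun t => L * (|y i - x i| * axisDensity G i p p' (x i + (y i - x i) * t)) + b
    with hF
  have hFc : Continuous F := by
    have : Continuous fun t : ℝ => axisDensity G i p p' (x i + (y i - x i) * t) :=
      hcont.comp (by fun_prop)
    fun_prop
  have hF0 : ∀ t, 0 ≤ F t := fun t => by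
    have := h.axisDensity_pos hG hKU (x i + (y i - x i) * t)
    have := h.nonneg
    positivity
  have hpt : ∀ t ∈ Icc (0 : ℝ) 1, localNorm (G (x + t • (y - x))) (y - x) ≤ F t := by
    intro t ht
    have hz : x + t • (y - x) ∈ K := h.convex.add_smul_sub_mem hx hy ht
    have hzi : (x + t • (y - x)) i = x i + (y i - x i) * t := by simp; ring
    set z := x + t • (y - x) with hz_def
    have h1 := h.chord_sub_le hG hKU hy hx hz
    have h2 : localNorm (G z) (axisDir i p p') ≤ L * axisDensity G i p p' (z i) :=
      h.comparison z hz _ (h.axisPoint_mem _) (h.axisPoint_apply (h.mem_Icc z hz)).symm _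
    have e : y - x = (y i - x i) • axisDir i p p' +
        ((y - x) - (y i - x i) • axisDir i p p') := by module
    calc localNorm (G z) (y - x) ≤ localNorm (G z) ((y i - x i) • axisDir i p p') +
          localNorm (G z) ((y - x) - (y i - x i) • axisDir i p p') := by
          conv_lhs => rw [e]
          exact localNorm_add_le (hG.posDef _ (hKU hz)) _ _
      _ ≤ |y i - x i| * (L * axisDensity G i p p' (z i)) + b := by
          rw [localNorm_smul]
          gcongr
      _ = F t := by rw [hF, hzi]; ring
  calc ∫⁻ t in Icc (0 : ℝ) 1, ENNReal.ofReal (localNorm (G (x + t • (y - x))) (y - x))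
      ≤ ∫⁻ t in Icc (0 : ℝ) 1, ENNReal.ofReal (F t) :=
        setLIntegral_mono' measurableSet_Icc fun t ht => ENNReal.ofReal_le_ofReal (hpt t ht)
    _ = ENNReal.ofReal |∫ t in (0 : ℝ)..1, F t| := by
        rw [← setLIntegral_uIcc_ofReal hFc hF0, uIcc_of_le zero_le_one]
    _ = ENNReal.ofReal (∫ t in (0 : ℝ)..1, F t) := by
        rw [abs_of_nonneg (intervalIntegral.integral_nonneg zero_le_one fun t _ => hF0 t)]
    _ = ENNReal.ofReal (L * |∫ s in (x i)..(y i), axisDensity G i p p' s| + b) := by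
        congr 1
        have hc1 : Continuous fun t : ℝ => axisDensity G i p p' (x i + (y i - x i) * t) :=
          hcont.comp (by fun_prop)
        rw [hF, intervalIntegral.integral_add
          (Continuous.intervalIntegrable (by fun_prop) _ _) intervalIntegrable_const,
          intervalIntegral.integral_const_mul, intervalIntegral.integral_const_mul]
        have e := intervalIntegral.smul_integral_comp_add_mul (a := 0) (b := 1)
          (axisDensity G i p p') (y i - x i) (x i)
        have e0 : 0 ≤ ∫ t in (0 : ℝ)..1, axisDensity G i p p' (x i + (y i - x i) * t) :=
          intervalIntegral.integral_nonneg zero_le_one fun t _ => (h.axisDensity_pos hG hKU _).le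
        have e1 : x i + (y i - x i) * 1 = y i := by ring
        have e2 : x i + (y i - x i) * 0 = x i := by ring
        rw [e1, e2] at e
        rw [← e, smul_eq_mul, abs_mul, abs_of_nonneg e0]
        simp

end IsTube

/-- The weight `exp (-f)` restricted to `K`. -/
def expWeight (f : EuclideanSpace ℝ (Fin (n + 1)) → ℝ) (K : Set (EuclideanSpace ℝ (Fin (n + 1)))) :
    EuclideanSpace ℝ (Fin (n + 1)) → ℝ≥0∞ :=
  K.indicator fun x => ENNReal.ofReal (Real.exp (-f x))

lemma measurable_expWeight {f : EuclideanSpace ℝ (Fin (n + 1)) → ℝ} (hf : ContinuousOn f K)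
    (hK : IsClosed K) : Measurable (expWeight f K) := by
  classical
  have h1 : ContinuousOn (fun x => ENNReal.ofReal (Real.exp (-f x))) K :=
    ENNReal.continuous_ofReal.comp_continuousOn (Real.continuous_exp.comp_continuousOn hf.neg)
  rw [expWeight, ← piecewise_eq_indicator]
  exact ContinuousOn.measurable_piecewise h1 continuousOn_const
    hK.measurableSet

variable {f : EuclideanSpace ℝ (Fin (n + 1)) → ℝ} {μ : ℝ}

/-- The gain factor in the log-concavity of the slice masses of a tube. -/
def gainFactor (G : EuclideanSpace ℝ (Fin (n + 1)) → Matrix (Fin (n + 1)) (Fin (n + 1)) ℝ)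
    (i : Fin (n + 1)) (L b μ : ℝ) (p p' : EuclideanSpace ℝ (Fin (n + 1))) (τ s : ℝ) : ℝ≥0∞ :=
  ENNReal.ofReal (Real.exp
    (-(μ * omega (max (axisDensity G i p p' τ / L * |s - τ| - b) 0))))

lemma IsTube.sliceMass_gain (h : IsTube G i L b p p' K) (hU : IsOpen U) (hUc : Convex ℝ U)
    (hKU : K ⊆ U) (hG : IsMetricOn G U) (hGsc : SelfConcordantOn G U)
    (hf : TwiceDifferentiableOn f U) (hμ : 0 ≤ μ) (hcurv : CurvatureLowerBoundOn μ G f U)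
    {s y t : ℝ} (ht0 : 0 < t) (ht1 : t < 1) :
    sliceMass i (expWeight f K) s ^ (1 - t) * sliceMass i (expWeight f K) y ^ t ≤
      sliceMass i (expWeight f K) ((1 - t) * s + t * y) *
        gainFactor G i L b μ p p' ((1 - t) * s + t * y) s ^ (1 - t) := by
  have hs : 0 < 1 - t := by linarith
  have hw : Measurable (expWeight f K) :=
    measurable_expWeight (hf.1.continuousOn.mono hKU) h.isCompact.isClosed
  refine sliceMass_rpow_mul_le i hw ht0 ht1 fun x x' hx hx' => ?_
  by_cases hxK : x ∈ K
  swap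
  · rw [expWeight, indicator_of_notMem hxK, ENNReal.zero_rpow_of_pos hs, zero_mul]
    exact zero_le
  by_cases hxK' : x' ∈ K
  swap
  · rw [expWeight, indicator_of_notMem hxK', ENNReal.zero_rpow_of_pos ht0, mul_zero]
    exact zero_le
  set z := (1 - t) • x + t • x' with hz
  have hzK : z ∈ K := h.convex hxK hxK' hs.le ht0.le (by ring)
  have hzi : z i = (1 - t) * s + t * y := by simp [hz, hx, hx']
  rw [expWeight, indicator_of_mem hxK, indicator_of_mem hxK', indicator_of_mem hzK, gainFactor,
    ENNReal.ofReal_rpow_of_pos (Real.exp_pos _), ENNReal.ofReal_rpow_of_pos (Real.exp_pos _),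
    ENNReal.ofReal_rpow_of_pos (Real.exp_pos _), ← Real.exp_mul, ← Real.exp_mul, ← Real.exp_mul,
    ← ENNReal.ofReal_mul (Real.exp_pos _).le, ← ENNReal.ofReal_mul (Real.exp_pos _).le,
    ← Real.exp_add, ← Real.exp_add]
  refine ENNReal.ofReal_le_ofReal (Real.exp_le_exp.2 ?_)
  have h1 := convex_gain hU hUc hG hGsc hf hμ hcurv (hKU hxK) (hKU hxK') ht0 ht1 hz.symm
  have h2 := h.axis_le_chord hG hKU hxK hzK
  rw [hzi, hx] at h2
  have h3 := omega_mono (le_max_right _ _) (max_le h2 (localNorm_nonneg _ _))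
  have h4 := mul_le_mul_of_nonneg_left (mul_le_mul_of_nonneg_left h3 hμ) hs.le
  linarith

lemma sliceMass_expWeight_eq_zero (hK : ∀ x ∈ K, x i ∈ Icc (p i) (p' i)) {s : ℝ}
    (hs : s ∉ Icc (p i) (p' i)) : sliceMass i (expWeight f K) s = 0 := by
  rw [sliceMass, ← lintegral_zero (α := Fin n → ℝ) (μ := volume)]
  refine lintegral_congr fun y => indicator_of_notMem (fun h => hs ?_) _
  simpa using hK _ h

/-- A bound of `q` by a constant times an integrable factor `E`, integrated, and rescaled by the
density `N`. -/
lemma ofReal_mul_lintegral_le {N L M : ℝ} (hN : 0 < N) (hL : 0 < L) {S : Set ℝ}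
    (hS : MeasurableSet S) {q : ℝ → ℝ≥0∞} {c : ℝ≥0∞} {E : ℝ → ℝ≥0∞} (hE : Measurable E)
    (hq : ∀ s ∈ S, q s ≤ c * E s) (hint : ∫⁻ s in S, E s ≤ ENNReal.ofReal (M / (N / L))) :
    ENNReal.ofReal N * ∫⁻ s in S, q s ≤ ENNReal.ofReal (L * M) * c := by
  calc ENNReal.ofReal N * ∫⁻ s in S, q s ≤ ENNReal.ofReal N * ∫⁻ s in S, c * E s := by
        gcongr 1
        exact setLIntegral_mono' hS hq
    _ = ENNReal.ofReal N * (c * ∫⁻ s in S, E s) := by rw [lintegral_const_mul _ hE]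
    _ ≤ ENNReal.ofReal N * (c * ENNReal.ofReal (M / (N / L))) := by gcongr
    _ = (ENNReal.ofReal N * ENNReal.ofReal (M / (N / L))) * c := by ring
    _ = _ := by
        rw [← ENNReal.ofReal_mul hN.le]
        congr 2
        field_simp

/-- Isoperimetry in a tube, up to errors that vanish with its thickness. -/
lemma IsTube.isoperimetry (h : IsTube G i L b p p' K) (hU : IsOpen U) (hUc : Convex ℝ U)
    (hKU : K ⊆ U) (hG : IsMetricOn G U) (hGsc : SelfConcordantOn G U)
    (hf : TwiceDifferentiableOn f U) (hμ : 0 < μ) (hcurv : CurvatureLowerBoundOn μ G f U)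
    {S₁ S₂ S₃ : Set (EuclideanSpace ℝ (Fin (n + 1)))} (hS₁ : MeasurableSet S₁)
    (hS₂ : MeasurableSet S₂) (hS₃ : MeasurableSet S₃) (hcover : K ⊆ S₁ ∪ S₂ ∪ S₃) {D : ℝ}
    (hbD : b < D) (hD : ∀ x ∈ S₁, ∀ y ∈ S₂, ENNReal.ofReal D ≤ geodesicDist G U x y) :
    ENNReal.ofReal ((D - b) / L) *
        min (∫⁻ x in S₁, expWeight f K x) (∫⁻ x in S₂, expWeight f K x) ≤
      ENNReal.ofReal (L * (b + (4 / μ + 2 / √μ))) * ∫⁻ x in S₃, expWeight f K x := by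
  have hL : 0 < L := lt_of_lt_of_le one_pos h.one_le
  have hw : Measurable (expWeight f K) :=
    measurable_expWeight (hf.1.continuousOn.mono hKU) h.isCompact.isClosed
  set w := expWeight f K with hw_def
  set q := sliceMass i w with hq_def
  have hqm : Measurable q := measurable_sliceMass i hw
  set N := axisDensity G i p p' with hN_def
  have hNc : Continuous N := h.continuous_axisDensity hG hKU
  have hN0 : ∀ s, 0 < N s := h.axisDensity_pos hG hKU
  set I := Icc (p i) (p' i) with hI_def
  set A := closure ((fun x : EuclideanSpace ℝ (Fin (n + 1)) => x i) '' (S₁ ∩ K)) with hA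
  set B := closure ((fun x : EuclideanSpace ℝ (Fin (n + 1)) => x i) '' (S₂ ∩ K)) with hB
  have hAI : A ⊆ I := closure_minimal (by rintro _ ⟨x, hx, rfl⟩; exact h.mem_Icc x hx.2) isClosed_Icc
  have hBI : B ⊆ I := closure_minimal (by rintro _ ⟨x, hx, rfl⟩; exact h.mem_Icc x hx.2) isClosed_Icc
  -- the separation of the projections along the axis
  have hsep : ∀ a ∈ A, ∀ c ∈ B, ENNReal.ofReal ((D - b) / L) ≤
      ∫⁻ τ in uIcc a c, ENNReal.ofReal (N τ) := by
    have hcl : IsClosed {z : ℝ × ℝ | (D - b) / L ≤ |∫ τ in z.1..z.2, N τ|} := by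
      have h1 : Continuous fun x => ∫ τ in (0 : ℝ)..x, N τ :=
        intervalIntegral.continuous_primitive (fun a b => hNc.intervalIntegrable a b) 0
      have h2 : Continuous fun z : ℝ × ℝ => |∫ τ in z.1..z.2, N τ| := by
        have e : (fun z : ℝ × ℝ => |∫ τ in z.1..z.2, N τ|) = fun z : ℝ × ℝ =>
            |(∫ τ in (0 : ℝ)..z.2, N τ) - ∫ τ in (0 : ℝ)..z.1, N τ| := by
          ext z
          rw [intervalIntegral.integral_interval_sub_left (hNc.intervalIntegrable _ _)
            (hNc.intervalIntegrable _ _)]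
        rw [e]
        exact ((h1.comp continuous_snd).sub (h1.comp continuous_fst)).abs
      exact isClosed_le continuous_const h2
    have hsub : A ×ˢ B ⊆ {z : ℝ × ℝ | (D - b) / L ≤ |∫ τ in z.1..z.2, N τ|} := by
      rw [hA, hB, ← closure_prod_eq]
      refine closure_minimal ?_ hcl
      rintro ⟨_, _⟩ ⟨⟨x, hx, rfl⟩, ⟨y, hy, rfl⟩⟩
      have h1 := (hD x hx.1 y hy.1).trans (h.geodesicDist_le hG hUc hKU hx.2 hy.2)
      have h2 : 0 ≤ L * |∫ s in (x i)..(y i), axisDensity G i p p' s| + b :=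
        add_nonneg (mul_nonneg hL.le (abs_nonneg _)) h.nonneg
      rw [ENNReal.ofReal_le_ofReal_iff h2] at h1
      change (D - b) / L ≤ |∫ τ in (x i)..(y i), N τ|
      rw [div_le_iff₀ hL]
      linarith
    intro a ha c hc
    rw [setLIntegral_uIcc_ofReal hNc (fun s => (hN0 s).le)]
    exact ENNReal.ofReal_le_ofReal (hsub (mk_mem_prod ha hc))
  -- the Cheeger-type bounds on the slice masses
  obtain ⟨m, hm⟩ := exists_center (I := I) (q := q) (E := gainFactor G i L b μ p p') bddBelow_Icc
    bddAbove_Icc (fun τ s => by simp [gainFactor, Real.exp_pos])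
    (fun s _ y _ t ht0 ht1 => h.sliceMass_gain hU hUc hKU hG hGsc hf hμ.le hcurv ht0 ht1)
  have hgm : ∀ τ, Measurable fun s => gainFactor G i L b μ p p' τ s := by
    intro τ
    unfold gainFactor omega
    fun_prop
  have hgi : ∀ τ, ∫⁻ u in Ioi 0, ENNReal.ofReal (Real.exp (-(μ * omega
      (max (N τ / L * u - b) 0)))) ≤ ENNReal.ofReal ((b + (4 / μ + 2 / √μ)) / (N τ / L)) :=
    fun τ => lintegral_exp_omega_le hμ (div_pos (hN0 τ) hL) h.nonneg
  have key := isoperimetry_line (I := I) ordConnected_Icc measurableSet_Icc hqm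
    (hNc.measurable.ennreal_ofReal) isClosed_closure isClosed_closure hAI hBI (m := m)
    (M := ENNReal.ofReal (L * (b + (4 / μ + 2 / √μ)))) (D := ENNReal.ofReal ((D - b) / L))
    (by simpa using div_pos (sub_pos.2 hbD) hL)
    (fun τ hτ hτm => by
      refine ofReal_mul_lintegral_le (hN0 τ) hL measurableSet_Iio (hgm τ) (fun s hs => ?_) ?_
      · by_cases hsI : s ∈ I
        · exact (hm τ hτ).1 hτm s hsI hs
        · rw [hq_def, sliceMass_expWeight_eq_zero h.mem_Icc hsI]
          exact zero_le
      · refine le_trans (le_of_eq ?_) (hgi τ)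
        rw [← setLIntegral_Iio_sub _ τ]
        refine setLIntegral_congr_fun measurableSet_Iio fun s hs => ?_
        simp only [gainFactor]
        rw [abs_sub_comm, abs_of_pos (sub_pos.2 hs)])
    (fun τ hτ hτm => by
      refine ofReal_mul_lintegral_le (hN0 τ) hL measurableSet_Ioi (hgm τ) (fun s hs => ?_) ?_
      · by_cases hsI : s ∈ I
        · exact (hm τ hτ).2 hτm s hsI hs
        · rw [hq_def, sliceMass_expWeight_eq_zero h.mem_Icc hsI]
          exact zero_le
      · refine le_trans (le_of_eq ?_) (hgi τ)
        rw [← setLIntegral_Ioi_sub _ τ]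
        refine setLIntegral_congr_fun measurableSet_Ioi fun s hs => ?_
        simp only [gainFactor]
        rw [abs_of_pos (sub_pos.2 hs)])
    hsep
  -- from masses of coordinate slabs back to masses of the sets
  have hci : Measurable fun x : EuclideanSpace ℝ (Fin (n + 1)) => x i := by fun_prop
  have hle : ∀ {S : Set (EuclideanSpace ℝ (Fin (n + 1)))}, MeasurableSet S →
      ∫⁻ x in S, w x ≤
        ∫⁻ s in closure ((fun x : EuclideanSpace ℝ (Fin (n + 1)) => x i) '' (S ∩ K)), q s := by
    intro S hS
    have hcm : MeasurableSet (closure ((fun x : EuclideanSpace ℝ (Fin (n + 1)) => x i) '' (S ∩ K))) :=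
      isClosed_closure.measurableSet
    rw [hq_def, ← setLIntegral_coord_preimage i hw hcm, ← lintegral_indicator hS,
      ← lintegral_indicator (hcm.preimage hci)]
    refine lintegral_mono fun x => ?_
    by_cases hx : x ∈ S
    swap
    · rw [indicator_of_notMem hx]
      exact zero_le
    by_cases hxK : x ∈ K
    · have hx' : x ∈ (fun x : EuclideanSpace ℝ (Fin (n + 1)) => x i) ⁻¹'
          closure ((fun x : EuclideanSpace ℝ (Fin (n + 1)) => x i) '' (S ∩ K)) :=
        subset_closure (mem_image_of_mem _ ⟨hx, hxK⟩)
      rw [indicator_of_mem hx, indicator_of_mem hx']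
    · have hx0 : w x = 0 := indicator_of_notMem hxK _
      rw [indicator_of_mem hx, hx0]
      exact zero_le
  have hC : ∫⁻ s in I \ (A ∪ B), q s ≤ ∫⁻ x in S₃, w x := by
    have hcm : MeasurableSet (I \ (A ∪ B)) :=
      measurableSet_Icc.diff (isClosed_closure.measurableSet.union isClosed_closure.measurableSet)
    rw [hq_def, ← setLIntegral_coord_preimage i hw hcm, ← lintegral_indicator hS₃,
      ← lintegral_indicator (hcm.preimage hci)]
    refine lintegral_mono fun x => ?_
    by_cases hx : x ∈ (fun x : EuclideanSpace ℝ (Fin (n + 1)) => x i) ⁻¹' (I \ (A ∪ B))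
    swap
    · rw [indicator_of_notMem hx]
      exact zero_le
    rw [indicator_of_mem hx]
    by_cases hxK : x ∈ K
    · have hx3 : x ∈ S₃ := by
        rcases hcover hxK with (h1 | h1) | h1
        · exact (hx.2 (Or.inl (subset_closure ⟨x, ⟨h1, hxK⟩, rfl⟩))).elim
        · exact (hx.2 (Or.inr (subset_closure ⟨x, ⟨h1, hxK⟩, rfl⟩))).elim
        · exact h1
      rw [indicator_of_mem hx3]
    · have hx0 : w x = 0 := indicator_of_notMem hxK _
      rw [hx0]
      exact zero_le
  calc _ ≤ ENNReal.ofReal ((D - b) / L) * min (∫⁻ s in A, q s) (∫⁻ s in B, q s) := by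
        gcongr
        · exact hle hS₁
        · exact hle hS₂
    _ ≤ _ := key
    _ ≤ _ := by gcongr

end Tube

/-! ### Exhaustion by compact convex bodies -/

section Exhaustion

variable {d : ℕ} {K : Set (EuclideanSpace ℝ (Fin d))}

/-- The points of the ball of radius `k` whose distance to the complement of `K` is at least
`1 / (k + 1)`. -/
def innerBody (K : Set (EuclideanSpace ℝ (Fin d))) (k : ℕ) : Set (EuclideanSpace ℝ (Fin d)) :=
  Metric.closedBall 0 k ∩ ⋂ v ∈ Metric.closedBall (0 : EuclideanSpace ℝ (Fin d)) (1 / (k + 1)),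
    (fun x => x + v) ⁻¹' K

lemma isCompact_innerBody (hK : IsClosed K) (k : ℕ) : IsCompact (innerBody K k) :=
  (isCompact_closedBall _ _).inter_right
    (isClosed_biInter fun v _ => hK.preimage (by fun_prop))

lemma convex_innerBody (hK : Convex ℝ K) (k : ℕ) : Convex ℝ (innerBody K k) :=
  (convex_closedBall _ _).inter (convex_iInter₂ fun v _ => hK.translate_preimage_left v)

lemma innerBody_subset (k : ℕ) : innerBody K k ⊆ interior K := by
  intro x hx
  have hk : (0 : ℝ) < 1 / (k + 1) := by positivity
  rw [mem_interior_iff_mem_nhds]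
  refine mem_of_superset (Metric.closedBall_mem_nhds x hk) fun y hy => ?_
  have := mem_iInter₂.1 hx.2 (y - x) (by simpa [dist_eq_norm] using hy)
  simpa using this

lemma innerBody_mono : Monotone (innerBody K) := by
  intro k l hkl x hx
  have hkl' : (k : ℝ) ≤ l := by exact_mod_cast hkl
  refine ⟨Metric.closedBall_subset_closedBall hkl' hx.1, mem_iInter₂.2 fun v hv => ?_⟩
  refine mem_iInter₂.1 hx.2 v (Metric.closedBall_subset_closedBall ?_ hv)
  gcongr

lemma iUnion_innerBody : ⋃ k, innerBody K k = interior K := by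
  refine Subset.antisymm (iUnion_subset fun k => innerBody_subset k) fun x hx => ?_
  obtain ⟨ε, hε, hball⟩ := Metric.mem_nhds_iff.1 (mem_interior_iff_mem_nhds.1 hx)
  obtain ⟨k₁, hk₁⟩ := exists_nat_one_div_lt hε
  obtain ⟨k₂, hk₂⟩ := exists_nat_ge ‖x‖
  have h1 : ((max k₁ k₂ : ℕ) : ℝ) ≥ k₁ := by exact_mod_cast le_max_left _ _
  have h2 : ((max k₁ k₂ : ℕ) : ℝ) ≥ k₂ := by exact_mod_cast le_max_right _ _
  refine mem_iUnion.2 ⟨max k₁ k₂, ?_, mem_iInter₂.2 fun v hv => hball ?_⟩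
  · rw [mem_closedBall_zero_iff]
    linarith
  · rw [mem_closedBall_zero_iff] at hv
    have h3 : 1 / (((max k₁ k₂ : ℕ) : ℝ) + 1) ≤ 1 / ((k₁ : ℝ) + 1) := by gcongr
    simp only [Metric.mem_ball, dist_self_add_left]
    linarith

end Exhaustion

/-! ### Isoperimetry for the log-concave distribution -/

section Distribution

variable {d : ℕ} {K : Set (EuclideanSpace ℝ (Fin d))} {f : EuclideanSpace ℝ (Fin d) → ℝ}
  {P : Measure (EuclideanSpace ℝ (Fin d))}

lemma IsLogConcaveDistribution.absolutelyContinuous (hP : IsLogConcaveDistribution P K f) :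
    P ≪ volume := by
  rw [hP.eq_withDensity]
  exact Measure.smul_absolutelyContinuous.trans
    ((withDensity_absolutelyContinuous _ _).trans Measure.restrict_le_self.absolutelyContinuous)

lemma IsLogConcaveDistribution.measure_inter_interior (hP : IsLogConcaveDistribution P K f)
    {S : Set (EuclideanSpace ℝ (Fin d))} : P (S ∩ interior K) = P S := by
  refine measure_inter_conull ?_
  have h : (volume.restrict (interior K)) (interior K)ᶜ = 0 := by
    rw [Measure.restrict_apply isOpen_interior.measurableSet.compl]
    simp
  rw [hP.eq_withDensity, Measure.smul_apply, withDensity_absolutelyContinuous _ _ h, smul_zero]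

end Distribution

variable {n : ℕ} {K : Set (EuclideanSpace ℝ (Fin (n + 1)))}
  {f : EuclideanSpace ℝ (Fin (n + 1)) → ℝ} {P : Measure (EuclideanSpace ℝ (Fin (n + 1)))}

lemma IsLogConcaveDistribution.measure_inter_eq (hP : IsLogConcaveDistribution P K f)
    {S T : Set (EuclideanSpace ℝ (Fin (n + 1)))} (hS : MeasurableSet S) (hT : MeasurableSet T)
    (hTK : T ⊆ interior K) :
    P (S ∩ T) = (∫⁻ x in interior K, ENNReal.ofReal (Real.exp (-f x)))⁻¹ *
      ∫⁻ x in S, expWeight f T x := by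
  conv_lhs => rw [hP.eq_withDensity]
  rw [Measure.smul_apply, withDensity_apply _ (hS.inter hT), Measure.restrict_restrict (hS.inter hT),
    inter_assoc, inter_eq_left.2 hTK, smul_eq_mul, expWeight, lintegral_indicator hT,
    Measure.restrict_restrict hT, inter_comm]

variable {G : EuclideanSpace ℝ (Fin (n + 1)) → Matrix (Fin (n + 1)) (Fin (n + 1)) ℝ} {μ : ℝ}

/-- A thin convex body of positive volume on which the metric is close to constant on slices is a
tube. -/
lemma exists_isTube {T : Set (EuclideanSpace ℝ (Fin (n + 1)))} (hT : IsCompact T)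
    (hTc : Convex ℝ T) (hTv : volume T ≠ 0) {i : Fin (n + 1)} {L C b ε : ℝ} (hL : 1 ≤ L)
    (hb : 0 ≤ b) (hC : ∀ z ∈ T, ∀ v, localNorm (G z) v ≤ C * ‖v‖) (hCb : C * ε ≤ b / 2)
    (hC0 : 0 ≤ C)
    (hcomp : ∀ z ∈ T, ∀ z' ∈ T, dist z z' < ε → ∀ v, localNorm (G z) v ≤ L * localNorm (G z') v)
    (hthin : ∀ x ∈ T, ∀ y ∈ T, x i = y i → dist x y < ε) :
    ∃ p p', IsTube G i L b p p' T := by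
  have hne : T.Nonempty := by
    by_contra h
    rw [not_nonempty_iff_eq_empty.1 h] at hTv
    simp at hTv
  have hci : ContinuousOn (fun x : EuclideanSpace ℝ (Fin (n + 1)) => x i) T :=
    (by fun_prop : Continuous fun x : EuclideanSpace ℝ (Fin (n + 1)) => x i).continuousOn
  obtain ⟨p, hp, hpmin⟩ := hT.exists_isMinOn hne hci
  obtain ⟨p', hp', hpmax⟩ := hT.exists_isMaxOn hne hci
  refine ⟨p, p', hT, hTc, hp, hp', lt_of_le_of_ne (hpmin hp') fun heq => hTv ?_,
    fun x hx => ⟨hpmin hx, hpmax hx⟩, hL, hb, fun z hz z' hz' h => hcomp z hz z' hz'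
      (hthin z hz z' hz' h), fun z hz x hx y hy h => ?_⟩
  · -- a body on which the coordinate is constant lies in a hyperplane
    let l : EuclideanSpace ℝ (Fin (n + 1)) →ₗ[ℝ] ℝ :=
      (EuclideanSpace.proj i : EuclideanSpace ℝ (Fin (n + 1)) →L[ℝ] ℝ)
    have hl : l ≠ 0 := by
      intro h
      have := LinearMap.congr_fun h (EuclideanSpace.single i 1)
      simp [l] at this
    refine measure_mono_null (fun x hx => ?_) (volume_level_set_eq_zero hl (p i))
    exact le_antisymm ((hpmax hx).trans heq.symm.le) (hpmin hx)
  · refine (hC z hz _).trans (le_trans ?_ hCb)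
    gcongr
    rw [← dist_eq_norm]
    exact (hthin x hx y hy h).le

lemma integral_indicator_sub {ρ : Measure (EuclideanSpace ℝ (Fin (n + 1)))} [IsFiniteMeasure ρ]
    {S S₃ : Set (EuclideanSpace ℝ (Fin (n + 1)))} (hS : MeasurableSet S) (hS₃ : MeasurableSet S₃)
    (c : ℝ) (T : Set (EuclideanSpace ℝ (Fin (n + 1)))) :
    ∫ x in T, (S.indicator (fun _ => c) x - S₃.indicator (fun _ => (1 : ℝ)) x) ∂ρ =
      c * ρ.real (S ∩ T) - ρ.real (S₃ ∩ T) := by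
  rw [integral_sub ((integrable_const c).indicator hS) ((integrable_const 1).indicator hS₃),
    integral_indicator_const _ hS, integral_indicator_const _ hS₃, measureReal_restrict_apply hS,
    measureReal_restrict_apply hS₃]
  simp [mul_comm]

/-- The isoperimetric inequality with a finite lower bound `D` on the separation. The inequality for
tubes has the better constant `1 / (4 / μ + 2 / √μ)`, twice the one claimed, and this slack absorbs
the errors due to the thickness of the tube. -/
lemma isoperimetry_of_separated (hP : IsLogConcaveDistribution P K f)
    (hG : IsMetricOn G (interior K)) (hGsc : SelfConcordantOn G (interior K))
    (hf : TwiceDifferentiableOn f (interior K)) (hμ : 0 < μ)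
    (hcurv : CurvatureLowerBoundOn μ G f (interior K))
    {S₁ S₂ S₃ : Set (EuclideanSpace ℝ (Fin (n + 1)))} (hS₁ : MeasurableSet S₁)
    (hS₂ : MeasurableSet S₂) (hS₃ : MeasurableSet S₃) (hcover : K ⊆ S₁ ∪ S₂ ∪ S₃) {D : ℝ}
    (hD0 : 0 < D)
    (hD : ∀ x ∈ S₁, ∀ y ∈ S₂, ENNReal.ofReal D ≤ geodesicDist G (interior K) x y) :
    D / (2 * (4 / μ + 2 / √μ)) * min (P.real S₁) (P.real S₂) ≤ P.real S₃ := by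
  have := hP.isProbabilityMeasure
  set M := 4 / μ + 2 / √μ with hM
  have hM0 : 0 < M := by positivity
  set c := D / (2 * M) with hc
  have hc0 : 0 < c := by positivity
  by_contra! hcon
  have hU : IsOpen (interior K) := isOpen_interior
  have hUc : Convex ℝ (interior K) := hP.convex.interior
  -- a compact convex body inside the interior that already violates the inequality
  have htend : ∀ S, Tendsto (fun k => P.real (S ∩ innerBody K k)) atTop (𝓝 (P.real S)) := by
    intro S
    have h1 : Tendsto (fun k => P (S ∩ innerBody K k)) atTop (𝓝 (P (⋃ k, S ∩ innerBody K k))) :=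
      tendsto_measure_iUnion_atTop fun k l hkl => inter_subset_inter_right _ (innerBody_mono hkl)
    rw [← inter_iUnion, iUnion_innerBody, hP.measure_inter_interior] at h1
    exact (ENNReal.tendsto_toReal (measure_ne_top _ _)).comp h1
  have hev : ∀ S, P.real S₃ < c * P.real S → ∀ᶠ k in atTop,
      P.real S₃ < c * P.real (S ∩ innerBody K k) := fun S hS =>
    ((htend S).const_mul c).eventually_const_lt hS
  have hlt₁ : P.real S₃ < c * P.real S₁ := hcon.trans_le (by gcongr; exact min_le_left _ _)
  have hlt₂ : P.real S₃ < c * P.real S₂ := hcon.trans_le (by gcongr; exact min_le_right _ _)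
  obtain ⟨k, hk₁, hk₂⟩ := ((hev S₁ hlt₁).and (hev S₂ hlt₂)).exists
  set K₀ := innerBody K k with hK₀
  have hK₀U : K₀ ⊆ interior K := innerBody_subset k
  have hK₀c : IsCompact K₀ := isCompact_innerBody hP.isClosed k
  have hle₃ : P.real (S₃ ∩ K₀) ≤ P.real S₃ := measureReal_mono inter_subset_left
  have good : IsGoodBody P
      (fun x => S₁.indicator (fun _ => c) x - S₃.indicator (fun _ => (1 : ℝ)) x)
      (fun x => S₂.indicator (fun _ => c) x - S₃.indicator (fun _ => (1 : ℝ)) x) K₀ :=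
    ⟨hK₀c, convex_innerBody hP.convex k, by rw [integral_indicator_sub hS₁ hS₃]; linarith,
      by rw [integral_indicator_sub hS₂ hS₃]; linarith⟩
  have hint : ∀ {S : Set (EuclideanSpace ℝ (Fin (n + 1)))}, MeasurableSet S →
      Integrable (fun x => S.indicator (fun _ => c) x - S₃.indicator (fun _ => (1 : ℝ)) x) P :=
    fun hS => ((integrable_const c).indicator hS).sub ((integrable_const 1).indicator hS₃)
  -- a thin body inside it that still violates the inequality; the tolerances `11 / 10` and `b` are
  -- such that `11 / 10 * (b + M) / ((D - b) / (11 / 10))` stays below `2 * M / D`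
  obtain ⟨C, hC0, hC⟩ := hG.exists_norm_bound hK₀c hK₀U
  obtain ⟨ε₁, hε₁, hcomp⟩ := hG.exists_norm_comparison hK₀c hK₀U (L := 11 / 10) (by norm_num)
  set b := min M D / 10 with hb
  have hb0 : 0 < b := div_pos (lt_min hM0 hD0) (by norm_num)
  have hbM : b ≤ M / 10 := by rw [hb]; gcongr; exact min_le_left _ _
  have hbD : b ≤ D / 10 := by rw [hb]; gcongr; exact min_le_right _ _
  obtain ⟨T, hTK₀, hT, i, hthin⟩ := good.exists_thin hP.absolutelyContinuous (hint hS₁) (hint hS₂)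
    (ε := min ε₁ (b / (2 * C))) (lt_min hε₁ (by positivity))
  have hTU := hTK₀.trans hK₀U
  have p₁ := hT.pos₁
  have p₂ := hT.pos₂
  rw [integral_indicator_sub hS₁ hS₃] at p₁
  rw [integral_indicator_sub hS₂ hS₃] at p₂
  have hTv : volume T ≠ 0 := by
    intro h0
    have h1 : P T = 0 := hP.absolutelyContinuous h0
    have h2 : P.real (S₁ ∩ T) = 0 := by
      rw [measureReal_def, measure_mono_null inter_subset_right h1, ENNReal.toReal_zero]
    rw [h2] at p₁
    have : 0 ≤ P.real (S₃ ∩ T) := measureReal_nonneg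
    linarith
  obtain ⟨p, p', htube⟩ := exists_isTube (G := G) hT.isCompact hT.convex hTv (L := 11 / 10)
    (b := b) (C := C) (ε := min ε₁ (b / (2 * C))) (by norm_num) hb0.le
    (fun z hz => hC z (hTK₀ hz)) (by
      calc C * min ε₁ (b / (2 * C)) ≤ C * (b / (2 * C)) := by gcongr; exact min_le_right _ _
        _ = b / 2 := by field_simp) hC0.le
    (fun z hz z' hz' h => hcomp z (hTK₀ hz) z' (hTK₀ hz') (h.trans_le (min_le_left _ _))) hthin
  have key := htube.isoperimetry hU hUc hTU hG hGsc hf hμ hcurv hS₁ hS₂ hS₃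
    (hTU.trans (interior_subset.trans hcover)) (D := D) (by linarith) hD
  rw [← hM] at key
  have hTm := hT.isCompact.measurableSet
  -- the inequality for the tube, in terms of `P`
  have key' : (D - b) / (11 / 10) * min (P.real (S₁ ∩ T)) (P.real (S₂ ∩ T)) ≤
      11 / 10 * (b + M) * P.real (S₃ ∩ T) := by
    have h1 : ENNReal.ofReal ((D - b) / (11 / 10)) * min (P (S₁ ∩ T)) (P (S₂ ∩ T)) ≤
        ENNReal.ofReal (11 / 10 * (b + M)) * P (S₃ ∩ T) := by
      rw [hP.measure_inter_eq hS₁ hTm hTU, hP.measure_inter_eq hS₂ hTm hTU,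
        hP.measure_inter_eq hS₃ hTm hTU, ← mul_min, mul_left_comm, mul_left_comm (ENNReal.ofReal _)]
      gcongr
    have h2 := ENNReal.toReal_mono (ENNReal.mul_ne_top ENNReal.ofReal_ne_top (measure_ne_top _ _)) h1
    rw [ENNReal.toReal_mul, ENNReal.toReal_mul, ENNReal.toReal_ofReal (by
      apply div_nonneg <;> linarith), ENNReal.toReal_ofReal (by positivity),
      ENNReal.toReal_min (measure_ne_top _ _) (measure_ne_top _ _)] at h2
    exact h2
  set a := min (P.real (S₁ ∩ T)) (P.real (S₂ ∩ T)) with ha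
  have h3 : P.real (S₃ ∩ T) < c * a := by
    rw [ha, mul_min_of_nonneg _ _ hc0.le]
    exact lt_min (by linarith) (by linarith)
  have h3' : 0 ≤ P.real (S₃ ∩ T) := measureReal_nonneg
  have ha0 : 0 < a := by
    by_contra! h
    have := mul_nonpos_of_nonneg_of_nonpos hc0.le h
    linarith
  have h4 : (D - b) / (11 / 10) * a < 11 / 10 * (b + M) * (c * a) :=
    key'.trans_lt (mul_lt_mul_of_pos_left h3 (by positivity))
  have h5 : (D - b) / (11 / 10) < 11 / 10 * (b + M) * c := by
    rw [← mul_assoc] at h4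
    exact lt_of_mul_lt_mul_right h4 ha0.le
  have h6 : 11 / 10 * (b + M) * c ≤ 121 / 200 * D := by
    have h7 : (b + M) * c ≤ (11 / 10 * M) * c := by gcongr; linarith
    have h8 : M * c = D / 2 := by rw [hc]; field_simp
    nlinarith
  have h9 : 9 / 11 * D ≤ (D - b) / (11 / 10) := by
    rw [le_div_iff₀ (by norm_num)]
    linarith
  linarith

end RiemIso

end

theorem mainTheorem4 {d : ℕ} (K : Set (EuclideanSpace ℝ (Fin d)))
    (f : EuclideanSpace ℝ (Fin d) → ℝ) (P : Measure (EuclideanSpace ℝ (Fin d)))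
    (hP : RiemIso.IsLogConcaveDistribution P K f)
    (G : EuclideanSpace ℝ (Fin d) → Matrix (Fin d) (Fin d) ℝ)
    (hG : RiemIso.IsMetricOn G (interior K))
    (hGsc : RiemIso.SelfConcordantOn G (interior K))
    (hf : RiemIso.TwiceDifferentiableOn f (interior K))
    (μ : ℝ) (hμ : 0 ≤ μ)
    (hcurv : RiemIso.CurvatureLowerBoundOn μ G f (interior K))
    (S₁ S₂ S₃ : Set (EuclideanSpace ℝ (Fin d)))
    (hS₁ : MeasurableSet S₁) (hS₂ : MeasurableSet S₂) (hS₃ : MeasurableSet S₃)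
    (h₁₂ : Disjoint S₁ S₂) (h₁₃ : Disjoint S₁ S₃) (h₂₃ : Disjoint S₂ S₃)
    (hK : S₁ ∪ S₂ ∪ S₃ = K) :
    ENNReal.ofReal (μ / (8 + 4 * Real.sqrt μ)) *
        (⨅ x ∈ S₁, ⨅ y ∈ S₂, RiemIso.geodesicDist G (interior K) x y) *
        min (P S₁) (P S₂) ≤ P S₃ := by
  have := hP.isProbabilityMeasure
  rcases hμ.eq_or_lt with rfl | hμ
  · simp
  rcases d with _ | n
  · -- in dimension zero one of the two disjoint sets is empty
    have h : P S₁ = 0 ∨ P S₂ = 0 := by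
      rcases S₁.eq_empty_or_nonempty with h | ⟨x, hx⟩
      · simp [h]
      · rcases S₂.eq_empty_or_nonempty with h | ⟨y, hy⟩
        · simp [h]
        · exact absurd (Subsingleton.elim y x ▸ hy) (disjoint_left.1 h₁₂ hx)
    rcases h with h | h <;> simp [h]
  rw [mul_right_comm]
  -- an infinite separation is approximated by finite ones
  refine ENNReal.mul_le_of_forall_lt fun u hu D hD => ?_
  have hDt : D ≠ ⊤ := hD.ne_top
  rcases eq_or_ne D 0 with rfl | hD0
  · simp
  have key := RiemIso.isoperimetry_of_separated hP hG hGsc hf hμ hcurv hS₁ hS₂ hS₃ hK.ge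
    (ENNReal.toReal_pos hD0 hDt) (fun x hx y hy => by
      rw [ENNReal.ofReal_toReal hDt]
      exact hD.le.trans ((iInf₂_le x hx).trans (iInf₂_le y hy)))
  have e : D.toReal / (2 * (4 / μ + 2 / √μ)) = μ / (8 + 4 * √μ) * D.toReal := by
    have hs : 0 < √μ := Real.sqrt_pos.2 hμ
    have hss : √μ * √μ = μ := Real.mul_self_sqrt hμ.le
    have : 2 * (4 / μ + 2 / √μ) = (8 + 4 * √μ) / μ := by
      rw [eq_div_iff hμ.ne']
      field_simp
      nlinarith
    rw [this]
    field_simp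
  rw [e] at key
  calc u * D ≤ ENNReal.ofReal (μ / (8 + 4 * √μ)) * min (P S₁) (P S₂) * D := by
        gcongr
    _ = ENNReal.ofReal (μ / (8 + 4 * √μ) * D.toReal * min (P.real S₁) (P.real S₂)) := by
        have hmin : min (P.real S₁) (P.real S₂) = (min (P S₁) (P S₂)).toReal :=
          (ENNReal.toReal_min (measure_ne_top _ _) (measure_ne_top _ _)).symm
        rw [ENNReal.ofReal_mul (by positivity), ENNReal.ofReal_mul (by positivity),
          ENNReal.ofReal_toReal hDt, hmin, ENNReal.ofReal_toReal
            (ne_top_of_le_ne_top (measure_ne_top P S₁) (min_le_left _ _))]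
        ring
    _ ≤ ENNReal.ofReal (P.real S₃) := ENNReal.ofReal_le_ofReal key
    _ = P S₃ := ENNReal.ofReal_toReal (measure_ne_top _ _)
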